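/- Let $d \ge 2$ and consider site percolation on $\mathbb{Z}^d$ (with $x \sim y$ iff $\|x-y\|_1 = 1$): under $\mathbb{P}_p$ each site is open with probability $p$ and closed otherwise, independently of all other sites. Let $p_c = p_c(d) = \sup\{p \in [0,1] : \mathbb{P}_p(0 \text{ lies in an infinite open cluster}) = 0\}$ be the critical probability, and for an integer $n \ge 1$ let $\Lambda(n) = [-n,n]^d \cap \mathbb{Z}^d$. Write $\{x \leftrightarrow y \text{ in } \Lambda(m)\}$ for the event that there is an open path from $x$ to $y$ (a nearest-neighbour path all of whose sites, including $x$ and $y$, are open) which lies in $\Lambda(m)$. There is a constant $c' > 0$, which depends only on the dimension $d$, such that for all integers $n \ge 1$ and all $x, y \in \Lambda(n)$, $$\mathbb{P}_{p_c}\bigl(x \leftrightarrow y \text{ in } \Lambda(9n)\bigr) \ \ge\ \frac{c'}{n^{d^2}}.$$ -/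

import Mathlib

open MeasureTheory ProbabilityTheory

noncomputable section

namespace SitePercolation

/-- The nearest-neighbour graph on `ℤ^d`: `v ~ w` iff `‖v - w‖₁ = 1`. -/
def latticeGraph (d : ℕ) : SimpleGraph (Fin d → ℤ) where
  Adj v w := ∑ i, |v i - w i| = 1
  symm := ⟨fun v w h => by simpa only [abs_sub_comm] using h⟩
  loopless := ⟨fun v h => by simp at h⟩

/-- The set of lattice points of the box `[-n, n]^d`. -/
def box (d n : ℕ) : Set (Fin d → ℤ) :=
  {x | ∀ i, |x i| ≤ (n : ℤ)}

/-- `P_p`: each site of `ℤ^d` is open with probability `p`, independently of the others.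
A configuration is identified with its set of open sites. -/
def siteMeasure (d : ℕ) (p : unitInterval) : Measure (Set (Fin d → ℤ)) :=
  setBernoulli Set.univ p

/-- In the configuration `ω` there is an open path from `x` to `y` which lies in `Γ`: all
its vertices, endpoints included, are open and belong to `Γ`. -/
def ConnectedIn {d : ℕ} (Γ : Set (Fin d → ℤ)) (x y : Fin d → ℤ) (ω : Set (Fin d → ℤ)) : Prop :=
  ∃ w : (latticeGraph d).Walk x y, ∀ v ∈ w.support, v ∈ ω ∧ v ∈ Γ

/-- The open cluster of `x` (empty if `x` is closed). -/
def cluster {d : ℕ} (x : Fin d → ℤ) (ω : Set (Fin d → ℤ)) : Set (Fin d → ℤ) :=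
  {y | ConnectedIn Set.univ x y ω}

/-- The percolation probability `θ(p)`. -/
def theta (d : ℕ) (p : unitInterval) : ℝ :=
  (siteMeasure d p).real {ω | (cluster 0 ω).Infinite}

/-- The critical probability `p_c(d) = sup {p ∈ [0,1] : θ(p) = 0}`. -/
def criticalProb (d : ℕ) : unitInterval :=
  sSup {p | theta d p = 0}

end SitePercolation

end

/-! Two ingredients combine: a supply of sites that are reached from the origin with probability of
order `N ^ (-d)`, and a topological argument which writes `y - x` as a sum of at most `d` such sites
up to a bounded error.

Supply. Exploring the cluster of the origin inside a finite set `S` gives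
`measureReal_reachEvent_le`: reaching far requires exiting `S` and then reaching far afresh. If the
expected number of exits is below one, iteration gives exponential decay, hence `theta = 0`. This
number is continuous in the density, so at criticality it is at least one for every finite `S`
containing the origin (`one_le_sum_exitEvent_criticalProb`). Some exit site therefore has a good
connection probability, and growing the set of good sites yields a path of good sites from the
origin to the sphere of radius `N` (`exists_path_boxConn_ge`). Sorting absolute values folds it into
a curve `γ` in the chamber `v₁ ≥ … ≥ v_d ≥ 0`; by symmetry all signed permutations of its points are
good (`exists_chamber_path`).

Topology. Triangulate the boundary of a cube, with hat functions scaled by `‖p‖`. For each vertex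
`u` run `γ` up to the time given by the hat function of `u` at `p`, place the resulting point in the
chamber of `u`, and sum over `u`. The sum varies slowly with `p`. For large `p` some summand has
reached the wall `v₁ = N`, and in the coordinate that matters all summands have the sign of `p`, so
the map points outwards and has an approximate preimage of every `z` of norm below `N - C`. This is
a discrete Poincaré–Miranda theorem (`exists_approx_zero`), itself a consequence of Sperner's lemma
(`card_full_kuhnGrid`). At most `d` hat functions are nonzero at a given point since the boundary
has dimension `d - 1`; absence of cancellation bounds the partial sums. This is
`exists_sum_signed_perms`.

Conclusion. Harris' inequality and translation invariance chain the steps from `x`. With `N = 3n`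
each costs a factor of order `n ^ (-d)`, and at most `d` of them give `n ^ (-d²)`; the remaining
bounded gap to `y` costs a constant, by opening a whole cube. -/

noncomputable section

namespace SitePercolation

/-! ### Cylinder events under the product measure. -/

section Bernoulli

variable {V : Type*}

/-- The event `E` is determined by the states of the sites in `F`. -/
def DeterminedBy (F : Set V) (E : Set (Set V)) : Prop :=
  ∀ ω ω' : Set V, ω ∩ F = ω' ∩ F → (ω ∈ E ↔ ω' ∈ E)

theorem DeterminedBy.mono {F F' : Set V} {E : Set (Set V)} (h : DeterminedBy F E) (hF : F ⊆ F') :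
    DeterminedBy F' E := fun ω ω' hω => h ω ω' (by
  rw [← Set.inter_eq_self_of_subset_right hF, ← Set.inter_assoc, ← Set.inter_assoc, hω])

theorem DeterminedBy.inter {F : Set V} {E E' : Set (Set V)} (h : DeterminedBy F E)
    (h' : DeterminedBy F E') : DeterminedBy F (E ∩ E') := fun ω ω' hω =>
  and_congr (h ω ω' hω) (h' ω ω' hω)

open Classical in
/-- The probability that the configuration restricted to `F` is `s ∩ F`. -/
def weight (p : unitInterval) (F s : Finset V) : ℝ :=
  ∏ i ∈ F, if i ∈ s then (p : ℝ) else 1 - p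

theorem weight_nonneg (p : unitInterval) (F s : Finset V) : 0 ≤ weight p F s :=
  Finset.prod_nonneg fun i _ => by
    split_ifs
    · exact p.2.1
    · linarith [p.2.2]

open Classical in
theorem measureReal_restrict_eq (p : unitInterval) (F s : Finset V) (hs : s ⊆ F) :
    (setBernoulli (Set.univ : Set V) p).real {ω | ω ∩ (F : Set V) = s} = weight p F s := by
  have h : (fun q : V → Prop => {i | q i}) ⁻¹' {ω : Set V | ω ∩ (F : Set V) = s} =
      Set.pi (F : Set V) (fun i => if i ∈ s then {True} else {False}) := by
    ext q
    simp only [Set.mem_preimage, Set.mem_ofPred_eq, Set.mem_pi, Finset.mem_coe]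
    constructor
    · intro hq i hi
      have := Set.ext_iff.1 hq i
      simp only [Set.mem_inter_iff, Set.mem_ofPred_eq, Finset.mem_coe, hi, and_true] at this
      split_ifs with h <;> simp_all
    · intro hq
      ext i
      simp only [Set.mem_inter_iff, Set.mem_ofPred_eq, Finset.mem_coe]
      constructor
      · rintro ⟨h1, h2⟩
        have := hq i h2
        by_contra h3
        simp_all
      · intro h1
        have := hq i (hs h1)
        simp_all
        exact hs h1
  rw [measureReal_def, setBernoulli_apply', h, Measure.infinitePi_pi, ENNReal.toReal_prod, weight]
  · refine Finset.prod_congr rfl fun i _ => ?_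
    split_ifs <;> simp
  · intro i _
    exact MeasurableSet.of_discrete

theorem measurableSet_restrict_eq (F s : Finset V) (hs : s ⊆ F) :
    MeasurableSet {ω : Set V | ω ∩ (F : Set V) = s} := by
  have : {ω : Set V | ω ∩ (F : Set V) = s} =
      ⋂ i ∈ F, {ω : Set V | i ∈ ω ↔ i ∈ s} := by
    ext ω
    simp only [Set.mem_ofPred_eq, Set.mem_iInter]
    constructor
    · intro h i hi
      have := Set.ext_iff.1 h i
      simpa [hi] using this
    · intro h
      ext i
      simp only [Set.mem_inter_iff, Finset.mem_coe]
      exact ⟨fun hi => (h i hi.2).1 hi.1, fun hi => ⟨(h i (hs hi)).2 hi, hs hi⟩⟩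
  rw [this]
  refine Finset.measurableSet_biInter _ fun i _ => ?_
  exact (measurable_set_mem i (MeasurableSet.of_discrete (s := {q : Prop | q ↔ i ∈ s})))

open Classical in
theorem DeterminedBy.eq_biUnion {F : Finset V} {E : Set (Set V)}
    (hE : DeterminedBy (F : Set V) E) :
    E = ⋃ s ∈ F.powerset.filter (fun s : Finset V => (s : Set V) ∈ E),
      {ω : Set V | ω ∩ (F : Set V) = s} := by
  ext ω
  simp only [Set.mem_iUnion, Finset.mem_filter, Finset.mem_powerset, Set.mem_ofPred_eq,
    exists_prop]
  constructor
  · intro hω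
    have hc : ((F.filter (· ∈ ω) : Finset V) : Set V) = ω ∩ F := by
      ext i; simp [and_comm]
    refine ⟨F.filter (· ∈ ω), ⟨Finset.filter_subset _ _, ?_⟩, hc.symm⟩
    rw [hc]
    exact (hE ω _ (by rw [Set.inter_assoc, Set.inter_self])).1 hω
  · rintro ⟨s, ⟨hs, hsE⟩, hω⟩
    refine (hE ω s ?_).2 hsE
    rw [hω, Set.inter_eq_self_of_subset_left (by exact_mod_cast hs)]

theorem DeterminedBy.measurableSet {F : Finset V} {E : Set (Set V)}
    (hE : DeterminedBy (F : Set V) E) : MeasurableSet E := by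
  classical
  rw [hE.eq_biUnion]
  exact Finset.measurableSet_biUnion _ fun s hs =>
    measurableSet_restrict_eq F s (Finset.mem_powerset.1 (Finset.mem_filter.1 hs).1)

open Classical in
/-- The probability of a cylinder event as a finite sum. -/
theorem measureReal_eq_sum (p : unitInterval) (F : Finset V) (E : Set (Set V))
    (hE : DeterminedBy (F : Set V) E) :
    (setBernoulli (Set.univ : Set V) p).real E =
      ∑ s ∈ F.powerset, if (s : Set V) ∈ E then weight p F s else 0 := by
  conv_lhs => rw [hE.eq_biUnion]
  rw [measureReal_biUnion_finset, Finset.sum_filter]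
  · refine Finset.sum_congr rfl fun s hs => ?_
    split_ifs
    · exact measureReal_restrict_eq p F s (Finset.mem_powerset.1 hs)
    · rfl
  · intro s _ t _ hst
    refine Set.disjoint_left.2 fun ω h1 h2 => hst ?_
    have h3 : (s : Set V) = t := h1.symm.trans h2
    exact_mod_cast h3
  · intro s hs
    exact measurableSet_restrict_eq F s (Finset.mem_powerset.1 (Finset.mem_filter.1 hs).1)

/-- **Harris inequality** for increasing cylinder events. -/
theorem measureReal_mul_le_inter (p : unitInterval) (F : Finset V) {E E' : Set (Set V)}
    (hE : DeterminedBy (F : Set V) E) (hE' : DeterminedBy (F : Set V) E')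
    (hup : IsUpperSet E) (hup' : IsUpperSet E') :
    (setBernoulli (Set.univ : Set V) p).real E * (setBernoulli (Set.univ : Set V) p).real E' ≤
      (setBernoulli (Set.univ : Set V) p).real (E ∩ E') := by
  classical
  have h1 : (setBernoulli (Set.univ : Set V) p).real Set.univ = 1 := by simp
  rw [← one_mul ((setBernoulli (Set.univ : Set V) p).real (E ∩ E')), ← h1,
    measureReal_eq_sum p F E hE, measureReal_eq_sum p F E' hE',
    measureReal_eq_sum p F (E ∩ E') (hE.inter hE'),
    measureReal_eq_sum p F Set.univ (fun _ _ _ => by simp)]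
  -- Weights are multiplicative for meet and join, so the four functions hypothesis holds with
  -- equality when both events occur. The factor 1 introduced above, written as the total mass, is
  -- the function on the meets.
  have key := four_functions_theorem
    (f₁ := fun s : Finset V => if (s : Set V) ∈ E then weight p F s else 0)
    (f₂ := fun s : Finset V => if (s : Set V) ∈ E' then weight p F s else 0)
    (f₃ := fun s : Finset V => if (s : Set V) ∈ Set.univ then weight p F s else 0)
    (f₄ := fun s : Finset V => if (s : Set V) ∈ E ∩ E' then weight p F s else 0)
    ?_ ?_ ?_ ?_ ?_ F.powerset F.powerset
  · simpa using key
  · intro s; dsimp; split_ifs; exacts [weight_nonneg _ _ _, le_rfl]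
  · intro s; dsimp; split_ifs; exacts [weight_nonneg _ _ _, le_rfl]
  · intro s; simpa using weight_nonneg p F s
  · intro s; dsimp; split_ifs; exacts [weight_nonneg _ _ _, le_rfl]
  · intro s t
    have hw : weight p F s * weight p F t = weight p F (s ∩ t) * weight p F (s ∪ t) := by
      simp only [weight, ← Finset.prod_mul_distrib]
      refine Finset.prod_congr rfl fun i _ => ?_
      by_cases hs : i ∈ s <;> by_cases ht : i ∈ t <;> simp [hs, ht, mul_comm]
    by_cases hs : (s : Set V) ∈ E
    · by_cases ht : (t : Set V) ∈ E'
      · have h2 : ((s ⊔ t : Finset V) : Set V) ∈ E ∩ E' := by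
          constructor
          · exact hup (by simp) hs
          · exact hup' (by simp) ht
        simp only [hs, ht, h2, Set.mem_univ, if_true]
        exact hw.le
      · simp only [ht, if_false, mul_zero]
        refine mul_nonneg ?_ ?_ <;> split_ifs <;> first | exact weight_nonneg _ _ _ | exact le_rfl
    · simp only [hs, if_false, zero_mul]
      refine mul_nonneg ?_ ?_ <;> split_ifs <;> first | exact weight_nonneg _ _ _ | exact le_rfl

/-- Cylinder events on disjoint sets of sites are independent. -/
theorem measureReal_inter_of_disjoint (p : unitInterval) (F F' : Finset V) (hF : Disjoint F F')
    {E E' : Set (Set V)} (hE : DeterminedBy (F : Set V) E) (hE' : DeterminedBy (F' : Set V) E') :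
    (setBernoulli (Set.univ : Set V) p).real (E ∩ E') =
      (setBernoulli (Set.univ : Set V) p).real E *
        (setBernoulli (Set.univ : Set V) p).real E' := by
  classical
  have hEu : DeterminedBy ((F ∪ F' : Finset V) : Set V) E := hE.mono (by simp)
  have hEu' : DeterminedBy ((F ∪ F' : Finset V) : Set V) E' := hE'.mono (by simp)
  rw [measureReal_eq_sum p F E hE, measureReal_eq_sum p F' E' hE',
    measureReal_eq_sum p (F ∪ F') _ (hEu.inter hEu'), Finset.sum_mul_sum, ← Finset.sum_product']
  have hd : ∀ i, i ∈ F → i ∉ F' := fun i h h' => Finset.disjoint_left.1 hF h h'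
  refine Finset.sum_bij' (fun s _ => (s ∩ F, s ∩ F')) (fun q _ => q.1 ∪ q.2) ?_ ?_ ?_ ?_ ?_
  · intro s _; simp
  · rintro ⟨a, b⟩ h
    simp only [Finset.mem_product, Finset.mem_powerset] at h ⊢
    exact Finset.union_subset_union h.1 h.2
  · intro s hs
    simp only [Finset.mem_powerset] at hs
    dsimp
    rw [← Finset.inter_union_distrib_left, Finset.inter_eq_left.2 hs]
  · rintro ⟨a, b⟩ h
    simp only [Finset.mem_product, Finset.mem_powerset] at h
    ext i
    · have := hd i
      have := @h.1 i
      have := @h.2 i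
      simp only [Finset.mem_inter, Finset.mem_union]; tauto
    · have := hd i
      have := @h.1 i
      have := @h.2 i
      simp only [Finset.mem_inter, Finset.mem_union]; tauto
  · intro s _
    have h1 : (s : Set V) ∈ E ↔ ((s ∩ F : Finset V) : Set V) ∈ E :=
      hE _ _ (by simp [Set.inter_assoc])
    have h2 : (s : Set V) ∈ E' ↔ ((s ∩ F' : Finset V) : Set V) ∈ E' :=
      hE' _ _ (by simp [Set.inter_assoc])
    have hw : weight p (F ∪ F') s = weight p F (s ∩ F) * weight p F' (s ∩ F') := by
      rw [weight, Finset.prod_union hF, weight, weight]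
      congr 1 <;> exact Finset.prod_congr rfl fun i hi => by simp [hi]
    simp only [Set.mem_inter_iff, h1, h2, hw]
    by_cases ha : ((s ∩ F : Finset V) : Set V) ∈ E <;>
      by_cases hb : ((s ∩ F' : Finset V) : Set V) ∈ E' <;> simp only [ha, hb] <;> simp

/-- Invariance of the product measure under a permutation of the sites. -/
theorem measureReal_preimage_image (p : unitInterval) (F : Finset V) (e : V ≃ V) {E : Set (Set V)}
    (hE : DeterminedBy (F : Set V) E) :
    (setBernoulli (Set.univ : Set V) p).real {ω | e ⁻¹' ω ∈ E} =
      (setBernoulli (Set.univ : Set V) p).real E := by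
  classical
  have hE' : DeterminedBy ((F.map e.toEmbedding : Finset V) : Set V) {ω | e ⁻¹' ω ∈ E} := by
    intro ω ω' h
    refine hE _ _ ?_
    have := congrArg (fun s => e ⁻¹' s) h
    simpa [Set.preimage_inter, Set.preimage_image_eq _ e.injective] using this
  rw [measureReal_eq_sum p F E hE, measureReal_eq_sum p _ _ hE']
  refine Finset.sum_bij' (fun s _ => s.map e.symm.toEmbedding) (fun s _ => s.map e.toEmbedding)
    ?_ ?_ ?_ ?_ ?_
  · intro s hs
    simp only [Finset.mem_powerset] at hs ⊢
    intro i hi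
    obtain ⟨j, hj, rfl⟩ := Finset.mem_map.1 hi
    obtain ⟨k, hk, rfl⟩ := Finset.mem_map.1 (hs hj)
    simpa using hk
  · intro s hs
    simp only [Finset.mem_powerset] at hs ⊢
    exact Finset.map_subset_map.2 hs
  · intro s _
    ext i; simp
  · intro s _
    ext i; simp
  · intro s _
    have h1 : e ⁻¹' (s : Set V) = ((s.map e.symm.toEmbedding : Finset V) : Set V) := by
      ext i; simp
    have h2 : weight p (F.map e.toEmbedding) s = weight p F (s.map e.symm.toEmbedding) := by
      simp only [weight, Finset.prod_map]
      exact Finset.prod_congr rfl fun i _ => by simp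
    simp only [Set.mem_ofPred_eq, h1, h2]

/-- The probability of a cylinder event is continuous in the density. -/
theorem continuous_measureReal (F : Finset V) {E : Set (Set V)}
    (hE : DeterminedBy (F : Set V) E) :
    Continuous fun p : unitInterval => (setBernoulli (Set.univ : Set V) p).real E := by
  classical
  simp only [fun p => measureReal_eq_sum p F E hE]
  refine continuous_finsetSum _ fun s _ => ?_
  split_ifs
  · refine continuous_finsetProd _ fun i _ => ?_
    split_ifs <;> fun_prop
  · exact continuous_const

/-- All sites of `F` are open with probability `p ^ |F|`. -/
theorem measureReal_subset (p : unitInterval) (F : Finset V) :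
    (setBernoulli (Set.univ : Set V) p).real {ω | (F : Set V) ⊆ ω} = (p : ℝ) ^ F.card := by
  classical
  have : {ω : Set V | (F : Set V) ⊆ ω} = {ω : Set V | ω ∩ (F : Set V) = F} := by
    ext ω; simp
  rw [this, measureReal_restrict_eq p F F subset_rfl, weight,
    Finset.prod_congr rfl (g := fun _ => (p : ℝ)) (fun i hi => by simp [hi]), Finset.prod_const]

end Bernoulli

/-! ### Sperner's lemma for the Kuhn triangulation. -/

section Sperner

/-- If `g` takes values `≤ n` on `{0, …, n}`, the number of `i` such that `g` maps the other indices
onto `{0, …, n - 1}` is odd iff `g` is onto `{0, …, n}`. -/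
theorem card_almost_surjective (n : ℕ) (g : ℕ → ℕ) (hg : ∀ i ∈ Finset.range (n + 1), g i ≤ n) :
    (((Finset.range (n + 1)).filter
      (fun i => ((Finset.range (n + 1)).erase i).image g = Finset.range n)).card : ZMod 2) =
      if (Finset.range (n + 1)).image g = Finset.range (n + 1) then 1 else 0 := by
  set R := Finset.range (n + 1) with hR
  have hcardR : R.card = n + 1 := Finset.card_range _
  split_ifs with h
  · have hinj : Set.InjOn g R := Finset.card_image_iff.1 (by rw [h])
    obtain ⟨i0, hi0, hgi0⟩ := Finset.mem_image.1 (show n ∈ R.image g by rw [h]; simp [hR])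
    have : R.filter (fun i => (R.erase i).image g = Finset.range n) = {i0} := by
      ext i
      simp only [Finset.mem_filter, Finset.mem_singleton]
      constructor
      · rintro ⟨hi, him⟩
        by_contra hne
        have : g i0 ∈ (R.erase i).image g :=
          Finset.mem_image_of_mem _ (Finset.mem_erase.2 ⟨fun h => hne h.symm, hi0⟩)
        rw [him, hgi0] at this
        simp at this
      · rintro rfl
        refine ⟨hi0, ?_⟩
        ext v
        simp only [Finset.mem_image, Finset.mem_erase, Finset.mem_range]
        constructor
        · rintro ⟨j, ⟨hj, hjR⟩, rfl⟩
          refine lt_of_le_of_ne (hg j hjR) fun h' => hj (hinj hjR hi0 (h'.trans hgi0.symm))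
        · intro hv
          have : v ∈ R.image g := by rw [h]; simp [hR]; omega
          obtain ⟨j, hj, rfl⟩ := Finset.mem_image.1 this
          exact ⟨j, ⟨by rintro rfl; omega, hj⟩, rfl⟩
    rw [this]; simp
  · by_cases hex : ∃ i0 ∈ R, (R.erase i0).image g = Finset.range n
    · obtain ⟨i0, hi0, him⟩ := hex
      have hinj : Set.InjOn g (R.erase i0) := Finset.card_image_iff.1 (by
        rw [him, Finset.card_erase_of_mem hi0, hcardR]; simp)
      have hgi0 : g i0 < n := by
        refine lt_of_le_of_ne (hg i0 hi0) fun h' => h ?_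
        conv_lhs => rw [← Finset.insert_erase hi0, Finset.image_insert, him, h']
        rw [hR, Finset.range_add_one]
      obtain ⟨i1, hi1, hgi1⟩ := Finset.mem_image.1 (him ▸ Finset.mem_range.2 hgi0)
      have hne : i0 ≠ i1 := (Finset.mem_erase.1 hi1).1.symm
      have hi1R := (Finset.mem_erase.1 hi1).2
      -- The value `n` is missed, so `g i0` is a repetition of `g i1` and there is no other
      -- coincidence. Exactly these two indices can be omitted, an even number.
      have : R.filter (fun i => (R.erase i).image g = Finset.range n) = {i0, i1} := by
        ext i
        simp only [Finset.mem_filter, Finset.mem_insert, Finset.mem_singleton]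
        constructor
        · rintro ⟨hi, him'⟩
          by_contra! hcon
          have hinj' : Set.InjOn g (R.erase i) := Finset.card_image_iff.1 (by
            rw [him', Finset.card_erase_of_mem hi, hcardR]; simp)
          exact hne (hinj' (by simp [hi0, hcon.1.symm]) (by simp [hi1R, hcon.2.symm]) hgi1.symm)
        · rintro (rfl | rfl)
          · exact ⟨hi0, him⟩
          · refine ⟨hi1R, ?_⟩
            rw [← him]
            ext v
            simp only [Finset.mem_image, Finset.mem_erase]
            constructor
            · rintro ⟨j, ⟨hj, hjR⟩, rfl⟩
              by_cases hj0 : j = i0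
              · exact ⟨i, ⟨hne.symm, hi1R⟩, by rw [hj0, hgi1]⟩
              · exact ⟨j, ⟨hj0, hjR⟩, rfl⟩
            · rintro ⟨j, ⟨hj, hjR⟩, rfl⟩
              by_cases hj1 : j = i
              · exact ⟨i0, ⟨hne, hi0⟩, by rw [hj1, hgi1]⟩
              · exact ⟨j, ⟨hj1, hjR⟩, rfl⟩
      rw [this, Finset.card_pair hne]
      rfl
    · rw [Finset.filter_eq_empty_iff.2 fun i hi h' => hex ⟨i, hi, h'⟩]
      simp

variable {d : ℕ}

/-- The `j`-th vertex of the Kuhn simplex with base point `b` in which the coordinate `c` is raised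
at step `ρ c`. -/
def kuhnVertex (s : (Fin d → ℕ) × Equiv.Perm (Fin d)) (j : ℕ) : Fin d → ℕ :=
  fun c => s.1 c + if (s.2 c).val < j then 1 else 0

/-- The Kuhn simplices of dimension `k` in the face `[0,m]^k × {0}^(d-k)` of the cube `[0,m]^d`. -/
def kuhnGrid (d m k : ℕ) : Finset ((Fin d → ℕ) × Equiv.Perm (Fin d)) :=
  ((Fintype.piFinset fun _ => Finset.range m) ×ˢ Finset.univ).filter
    (fun s => ∀ c : Fin d, k ≤ c.val → s.1 c = 0 ∧ s.2 c = c)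

theorem mem_kuhnGrid {m k : ℕ} {s : (Fin d → ℕ) × Equiv.Perm (Fin d)} :
    s ∈ kuhnGrid d m k ↔ (∀ c, s.1 c < m) ∧ ∀ c : Fin d, k ≤ c.val → s.1 c = 0 ∧ s.2 c = c := by
  simp [kuhnGrid]

/-- Exchanges the ranks `i - 1` and `i`. -/
def rankSwap (d i : ℕ) : Equiv.Perm (Fin d) :=
  if h : 0 < i ∧ i < d then Equiv.swap ⟨i - 1, by omega⟩ ⟨i, h.2⟩ else 1

theorem rankSwap_val {i : ℕ} (h0 : 0 < i) (hi : i < d) (r : Fin d) :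
    (rankSwap d i r).val = if r.val = i then i - 1 else if r.val + 1 = i then i else r.val := by
  rw [rankSwap, dif_pos ⟨h0, hi⟩, Equiv.swap_apply_def]
  simp only [Fin.ext_iff]
  split_ifs <;> first | rfl | omega

/-- The neighbour of a Kuhn simplex across the facet opposite to its `i`-th vertex, with the index
of the new vertex. -/
def kuhnFlip (K : Fin d) (q : ((Fin d → ℕ) × Equiv.Perm (Fin d)) × ℕ) :
    ((Fin d → ℕ) × Equiv.Perm (Fin d)) × ℕ :=
  if q.2 = 0 then
    ((fun c => q.1.1 c + if (q.1.2 c).val = 0 then 1 else 0, q.1.2.trans K.cycleRange.symm),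
      K.val + 1)
  else if q.2 = K.val + 1 then
    ((fun c => q.1.1 c - if q.1.2 c = K then 1 else 0, q.1.2.trans K.cycleRange), 0)
  else ((q.1.1, q.1.2.trans (rankSwap d q.2)), q.2)

theorem cycleRange_val (K r : Fin d) :
    (K.cycleRange r).val = if r.val < K.val then r.val + 1 else if r = K then 0 else r.val := by
  rcases lt_trichotomy r K with h | h | h
  · rw [Fin.coe_cycleRange_of_lt h, if_pos (by simpa using h)]
  · subst h; simp [Fin.coe_cycleRange_of_le]
  · rw [Fin.cycleRange_of_gt h, if_neg (by rw [Fin.lt_def] at h; omega), if_neg h.ne']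

theorem cycleRange_symm_val (K r : Fin d) :
    (K.cycleRange.symm r).val =
      if r.val = 0 then K.val else if r.val ≤ K.val then r.val - 1 else r.val := by
  obtain ⟨t, rfl⟩ := K.cycleRange.surjective r
  rw [Equiv.symm_apply_apply]
  have := cycleRange_val K t
  simp only [Fin.ext_iff] at this
  split_ifs at this ⊢ <;> omega

/-- The base moves along the coordinate raised first, which is now raised last; all other ranks drop
by one, so the surviving vertices are renumbered by one. -/
theorem kuhnVertex_flip_zero (K : Fin d) (s : (Fin d → ℕ) × Equiv.Perm (Fin d)) {j : ℕ}
    (hj : j ≤ K.val) : kuhnVertex (kuhnFlip K (s, 0)).1 j = kuhnVertex s (j + 1) := by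
  funext c
  have h := cycleRange_symm_val K (s.2 c)
  simp only [kuhnVertex, kuhnFlip, if_true, Equiv.trans_apply]
  split_ifs at h ⊢ <;> omega

/-- The inverse move. The positivity hypothesis ensures that the truncated subtraction in the new
base is a true one. -/
theorem kuhnVertex_flip_last (K : Fin d) (s : (Fin d → ℕ) × Equiv.Perm (Fin d))
    (hs : ∀ c, s.2 c = K → 0 < s.1 c) {j : ℕ} (hj : j ≤ K.val) :
    kuhnVertex (kuhnFlip K (s, K.val + 1)).1 (j + 1) = kuhnVertex s j := by
  funext c
  have h := cycleRange_val K (s.2 c)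
  have h' := hs c
  simp only [kuhnVertex, kuhnFlip, if_true, Equiv.trans_apply, Nat.succ_ne_zero, if_false]
  simp only [Fin.ext_iff] at h h' ⊢
  split_ifs at h ⊢ <;> omega

theorem kuhnVertex_flip_mid (K : Fin d) (s : (Fin d → ℕ) × Equiv.Perm (Fin d)) {i : ℕ}
    (hi0 : i ≠ 0) (hi : i < K.val + 1) {j : ℕ} (hj : j ≠ i) :
    kuhnVertex (kuhnFlip K (s, i)).1 j = kuhnVertex s j := by
  funext c
  have h := rankSwap_val (Nat.pos_of_ne_zero hi0) (by omega) (s.2 c)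
  simp only [kuhnVertex, kuhnFlip, hi0, hi.ne, if_false, Equiv.trans_apply]
  split_ifs at h ⊢ <;> omega

theorem kuhnFlip_snd (K : Fin d) (s : (Fin d → ℕ) × Equiv.Perm (Fin d)) (i : ℕ) :
    (kuhnFlip K (s, i)).2 = if i = 0 then K.val + 1 else if i = K.val + 1 then 0 else i := by
  simp only [kuhnFlip]; split_ifs <;> rfl

/-- The facet opposite to the `i`-th vertex is shared with the neighbour. -/
theorem image_erase_kuhnFlip {α : Type*} [DecidableEq α] (ℓ : (Fin d → ℕ) → α) (K : Fin d)
    (s : (Fin d → ℕ) × Equiv.Perm (Fin d)) {i : ℕ} (hi : i ≤ K.val + 1)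
    (hs : i = K.val + 1 → ∀ c, s.2 c = K → 0 < s.1 c) :
    ((Finset.range (K.val + 2)).erase (kuhnFlip K (s, i)).2).image
        (fun j => ℓ (kuhnVertex (kuhnFlip K (s, i)).1 j)) =
      ((Finset.range (K.val + 2)).erase i).image (fun j => ℓ (kuhnVertex s j)) := by
  rw [kuhnFlip_snd]
  ext v
  simp only [Finset.mem_image, Finset.mem_erase, Finset.mem_range]
  by_cases h0 : i = 0
  · subst h0
    simp only [if_true]
    constructor
    · rintro ⟨j, hj, rfl⟩
      exact ⟨j + 1, by omega, by rw [kuhnVertex_flip_zero K s (by omega)]⟩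
    · rintro ⟨j, hj, rfl⟩
      refine ⟨j - 1, by omega, ?_⟩
      rw [kuhnVertex_flip_zero K s (by omega), Nat.sub_add_cancel (by omega)]
  · by_cases h1 : i = K.val + 1
    · subst h1
      simp only [h0, if_false, if_true]
      constructor
      · rintro ⟨j, hj, rfl⟩
        refine ⟨j - 1, by omega, ?_⟩
        rw [← kuhnVertex_flip_last K s (hs rfl) (by omega), Nat.sub_add_cancel (by omega)]
      · rintro ⟨j, hj, rfl⟩
        exact ⟨j + 1, by omega, by rw [kuhnVertex_flip_last K s (hs rfl) (by omega)]⟩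
    · simp only [h0, h1, if_false]
      constructor
      · rintro ⟨j, hj, rfl⟩
        exact ⟨j, hj, by rw [kuhnVertex_flip_mid K s h0 (by omega) hj.1]⟩
      · rintro ⟨j, hj, rfl⟩
        exact ⟨j, hj, by rw [kuhnVertex_flip_mid K s h0 (by omega) hj.1]⟩

theorem kuhnFlip_flip (K : Fin d) (s : (Fin d → ℕ) × Equiv.Perm (Fin d)) {i : ℕ}
    (hi : i ≤ K.val + 1) (hs : i = K.val + 1 → ∀ c, s.2 c = K → 0 < s.1 c) :
    kuhnFlip K (kuhnFlip K (s, i)) = (s, i) := by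
  obtain ⟨b, ρ⟩ := s
  by_cases h0 : i = 0
  · subst h0
    have : kuhnFlip K ((b, ρ), 0) = (((kuhnFlip K ((b, ρ), 0)).1), K.val + 1) := by
      simp [kuhnFlip]
    rw [this]
    simp only [kuhnFlip, if_true, Nat.succ_ne_zero, if_false]
    refine Prod.ext (Prod.ext ?_ ?_) rfl
    · funext c
      have h := cycleRange_symm_val K (ρ c)
      simp only [Equiv.trans_apply, Fin.ext_iff]
      split_ifs at h ⊢ <;> omega
    · ext c; simp
  · by_cases h1 : i = K.val + 1
    · subst h1
      simp only [kuhnFlip, if_true, Nat.succ_ne_zero, if_false]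
      refine Prod.ext (Prod.ext ?_ ?_) rfl
      · funext c
        have h := cycleRange_val K (ρ c)
        have h' := hs rfl c
        simp only [Fin.ext_iff] at h h'
        have hz : (K.cycleRange (ρ c)).val = 0 ↔ (ρ c).val = K.val := by
          split_ifs at h <;> omega
        simp only [Equiv.trans_apply, Fin.ext_iff, hz]
        by_cases hK : (ρ c).val = K.val
        · have : 0 < b c := h' hK
          simp only [hK, if_true]
          omega
        · simp only [hK, if_false, Nat.sub_zero, Nat.add_zero]
      · ext c; simp
    · simp only [kuhnFlip, h0, h1, if_false]
      refine Prod.ext (Prod.ext rfl ?_) rfl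
      ext c
      have h := rankSwap_val (Nat.pos_of_ne_zero h0) (by omega) (ρ c)
      have h' := rankSwap_val (Nat.pos_of_ne_zero h0) (by omega) (rankSwap d i (ρ c))
      simp only [Equiv.trans_apply]
      split_ifs at h h' <;> omega

theorem kuhnFlip_ne (K : Fin d) (s : (Fin d → ℕ) × Equiv.Perm (Fin d)) {i : ℕ}
    (hi : i ≤ K.val + 1) : kuhnFlip K (s, i) ≠ (s, i) := by
  intro h
  have h2 := congrArg Prod.snd h
  rw [kuhnFlip_snd] at h2
  by_cases h0 : i = 0
  · simp [h0] at h2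
  · by_cases h1 : i = K.val + 1
    · simp [h1] at h2
    · have h3 := congrArg (fun q => q.1.2 (s.2.symm ⟨i, by omega⟩)) h
      simp only [kuhnFlip, h0, h1, if_false, Equiv.trans_apply, Equiv.apply_symm_apply] at h3
      have := rankSwap_val (Nat.pos_of_ne_zero h0) (by omega) (⟨i, by omega⟩ : Fin d)
      rw [h3] at this
      simp at this
      omega

/-- Only the flip at vertex 0 can leave the grid, through a face `x c = m`. At the opposite face
truncated subtraction keeps the base at 0, so membership survives there although `kuhnFlip_flip`
would not apply. -/
theorem kuhnFlip_mem {m : ℕ} (K : Fin d) {s : (Fin d → ℕ) × Equiv.Perm (Fin d)}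
    (hsg : s ∈ kuhnGrid d m (K.val + 1)) {i : ℕ} (hi : i ≤ K.val + 1)
    (hs : i = 0 → ∀ c, (s.2 c).val = 0 → s.1 c + 1 < m) :
    (kuhnFlip K (s, i)).1 ∈ kuhnGrid d m (K.val + 1) := by
  rw [mem_kuhnGrid] at hsg ⊢
  obtain ⟨hb, hc⟩ := hsg
  by_cases h0 : i = 0
  · simp only [kuhnFlip, h0, if_true]
    constructor
    · intro c
      have := hb c
      have := hs h0 c
      split_ifs with h <;> [exact this h; simpa]
    · intro c hK
      obtain ⟨h1, h2⟩ := hc c hK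
      refine ⟨?_, ?_⟩
      · rw [h1, h2, if_neg (by omega)]
      · have h := cycleRange_symm_val K (s.2 c)
        rw [Equiv.trans_apply, Fin.ext_iff, h, h2]
        split_ifs <;> omega
  · by_cases h1 : i = K.val + 1
    · simp only [kuhnFlip, h1, if_true, if_false, Nat.succ_ne_zero]
      refine ⟨fun c => lt_of_le_of_lt (Nat.sub_le _ _) (hb c), fun c hK => ?_⟩
      obtain ⟨h1, h2⟩ := hc c hK
      refine ⟨by rw [h1, Nat.zero_sub], ?_⟩
      have h := cycleRange_val K (s.2 c)
      rw [Equiv.trans_apply, Fin.ext_iff, h, h2]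
      simp only [Fin.ext_iff]
      split_ifs <;> omega
    · simp only [kuhnFlip, h0, h1, if_false]
      refine ⟨hb, fun c hK => ?_⟩
      obtain ⟨h3, h2⟩ := hc c hK
      refine ⟨h3, ?_⟩
      have h := rankSwap_val (Nat.pos_of_ne_zero h0) (by omega) (s.2 c)
      rw [Equiv.trans_apply, Fin.ext_iff, h, h2]
      split_ifs <;> omega

/-- **Sperner's lemma** for the Kuhn triangulation of the cube: the number of fully labelled
simplices is odd. -/
theorem card_full_kuhnGrid {m : ℕ} (hm : 0 < m) (ℓ : (Fin d → ℕ) → ℕ) (hd : ∀ x, ℓ x ≤ d)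
    (h0 : ∀ x (c : Fin d), x c = 0 → ℓ x ≤ c.val) (h1 : ∀ x (c : Fin d), x c = m → ℓ x ≠ c.val)
    (k : ℕ) (hk : k ≤ d) :
    (((kuhnGrid d m k).filter fun s =>
      (Finset.range (k + 1)).image (fun j => ℓ (kuhnVertex s j)) = Finset.range (k + 1)).card :
        ZMod 2) = 1 := by
  induction k with
  | zero =>
    have : ((kuhnGrid d m 0).filter fun s =>
        (Finset.range (0 + 1)).image (fun j => ℓ (kuhnVertex s j)) = Finset.range (0 + 1)) =
        {(0, 1)} := by
      ext s
      simp only [Finset.mem_filter, mem_kuhnGrid, Finset.mem_singleton]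
      constructor
      · rintro ⟨⟨_, h⟩, _⟩
        exact Prod.ext (funext fun c => (h c (Nat.zero_le _)).1)
          (Equiv.ext fun c => (h c (Nat.zero_le _)).2)
      · rintro rfl
        refine ⟨⟨fun c => hm, fun c _ => ⟨rfl, rfl⟩⟩, ?_⟩
        have hv : kuhnVertex ((0, 1) : (Fin d → ℕ) × Equiv.Perm (Fin d)) 0 = 0 := by
          funext c; simp [kuhnVertex]
        have : ℓ 0 = 0 := by
          rcases Nat.eq_zero_or_pos d with hd0 | hd0
          · have := hd 0; omega
          · have := h0 0 ⟨0, hd0⟩ rfl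
            simpa using this
        simp [hv, this]
    rw [this]; simp
  | succ k ih =>
    have ih := ih (by omega)
    set K : Fin d := ⟨k, hk⟩ with hK
    have hKv : K.val = k := rfl
    set g : (Fin d → ℕ) × Equiv.Perm (Fin d) → ℕ → ℕ := fun s j => ℓ (kuhnVertex s j) with hg
    have hgle : ∀ s ∈ kuhnGrid d m (k + 1), ∀ i ∈ Finset.range (k + 1 + 1), g s i ≤ k + 1 := by
      intro s hs i hi
      rw [mem_kuhnGrid] at hs
      by_cases hlt : k + 1 < d
      · have := h0 (kuhnVertex s i) ⟨k + 1, hlt⟩ (by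
          have h2 := hs.2 ⟨k + 1, hlt⟩ le_rfl
          simp only [kuhnVertex, h2]
          rw [if_neg]
          simp only [Finset.mem_range] at hi
          simp only [not_lt]; omega)
        simpa using this
      · exact (hd _).trans (by omega)
    -- Double counting of pairs (simplex, facet with labels exactly `0, …, k`): modulo 2 each
    -- simplex contributes according to whether it is fully labelled.
    set P := (kuhnGrid d m (k + 1) ×ˢ Finset.range (k + 1 + 1)).filter
      (fun q => ((Finset.range (k + 1 + 1)).erase q.2).image (g q.1) = Finset.range (k + 1)) with hP
    have hsum : ((kuhnGrid d m (k + 1)).filter fun s =>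
        (Finset.range (k + 1 + 1)).image (g s) = Finset.range (k + 1 + 1)).card =
          (P.card : ZMod 2) := by
      rw [Finset.card_filter, Finset.card_filter, Finset.sum_product, Nat.cast_sum, Nat.cast_sum]
      refine Finset.sum_congr rfl fun s hs => ?_
      have := card_almost_surjective (k + 1) (g s) (hgle s hs)
      rw [Finset.card_filter] at this
      rw [this]
      split_ifs <;> simp
    have hPmem : ∀ q, q ∈ P ↔ (q.1 ∈ kuhnGrid d m (k + 1) ∧ q.2 < k + 1 + 1) ∧
        ((Finset.range (k + 1 + 1)).erase q.2).image (g q.1) = Finset.range (k + 1) := by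
      intro q
      rw [hP, Finset.mem_filter, Finset.mem_product, Finset.mem_range]
    -- Facets lying in a hyperplane `x c = 0`. All other pairs cancel under the flip, and these will
    -- turn out to be the full simplices of the face one dimension lower.
    set Q := P.filter (fun q => q.2 = k + 1 ∧ ∃ c, q.1.2 c = K ∧ q.1.1 c = 0) with hQ
    have hrest : ((P.filter (fun q => ¬ (q.2 = k + 1 ∧ ∃ c, q.1.2 c = K ∧ q.1.1 c = 0))).card :
        ZMod 2) = 0 := by
      rw [Finset.card_eq_sum_ones, Nat.cast_sum]
      have hlast : ∀ q ∈ P.filter (fun q => ¬ (q.2 = k + 1 ∧ ∃ c, q.1.2 c = K ∧ q.1.1 c = 0)),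
          q.2 = K.val + 1 → ∀ c, q.1.2 c = K → 0 < q.1.1 c := by
        intro q hq h2 c hc
        by_contra hcon
        exact (Finset.mem_filter.1 hq).2 ⟨h2, c, hc, by omega⟩
      refine Finset.sum_involution (fun q _ => kuhnFlip K q) ?_ ?_ ?_ ?_
      · intro q _
        exact CharTwo.add_self_eq_zero _
      · rintro ⟨s, i⟩ hq _
        have := ((hPmem _).1 (Finset.mem_filter.1 hq).1).1.2
        exact kuhnFlip_ne K s (by dsimp at this; omega)
      · rintro ⟨s, i⟩ hq
        have hl := hlast _ hq
        obtain ⟨⟨hsg, hi⟩, him⟩ := (hPmem _).1 (Finset.mem_filter.1 hq).1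
        dsimp only at hsg hi him hl
        have himf := image_erase_kuhnFlip ℓ K s (by omega : i ≤ K.val + 1) hl
        rw [Finset.mem_filter, hPmem]
        refine ⟨⟨⟨?_, ?_⟩, himf.trans him⟩, ?_⟩
        · refine kuhnFlip_mem K hsg (by omega) ?_
          -- If the flip crossed `x c = m`, the whole facet would lie in that hyperplane, where
          -- label `c` is forbidden; yet `c` is among its labels.
          rintro rfl c hc
          by_contra hcon
          rw [mem_kuhnGrid] at hsg
          have hcm : s.1 c + 1 = m := by have := hsg.1 c; omega
          have hck : c.val < k + 1 := by
            by_contra hge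
            have := hsg.2 c (by omega)
            rw [this.2] at hc; omega
          have : c.val ∈ ((Finset.range (k + 1 + 1)).erase 0).image (g s) := by
            rw [him]; simpa using hck
          obtain ⟨j, hj, hj'⟩ := Finset.mem_image.1 this
          simp only [Finset.mem_erase] at hj
          exact h1 (kuhnVertex s j) c (by
            simp only [kuhnVertex, hc]
            rw [if_pos (by omega), hcm]) hj'
        · rw [kuhnFlip_snd]; split_ifs <;> omega
        · rintro ⟨hi2, c, hc, hc0⟩
          rw [kuhnFlip_snd] at hi2
          by_cases hi0 : i = 0
          · subst hi0
            simp only [kuhnFlip, if_true] at hc hc0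
            rw [Equiv.trans_apply, Equiv.symm_apply_eq] at hc
            have : (s.2 c).val = 0 := by rw [hc, cycleRange_val]; simp
            rw [if_pos this] at hc0
            omega
          · rw [if_neg hi0] at hi2
            split_ifs at hi2 <;> omega
      · rintro ⟨s, i⟩ hq
        have hl := hlast _ hq
        have := ((hPmem _).1 (Finset.mem_filter.1 hq).1).1.2
        exact kuhnFlip_flip K s (by dsimp at this; omega) hl
    have hQcard : Q.card = ((kuhnGrid d m k).filter fun s =>
        (Finset.range (k + 1)).image (g s) = Finset.range (k + 1)).card := by
      have her : (Finset.range (k + 1 + 1)).erase (k + 1) = Finset.range (k + 1) := by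
        rw [Finset.range_add_one, Finset.erase_insert (by simp)]
      refine Finset.card_bij' (fun q _ => q.1) (fun s _ => (s, k + 1)) ?_ ?_ ?_ ?_
      · rintro ⟨s, i⟩ hq
        obtain ⟨hqP, hi, c, hc, hc0⟩ := Finset.mem_filter.1 hq
        obtain ⟨⟨hsg, -⟩, him⟩ := (hPmem _).1 hqP
        dsimp only at hsg hi hc hc0 him
        subst hi
        rw [her] at him
        rw [Finset.mem_filter]
        refine ⟨?_, him⟩
        rw [mem_kuhnGrid] at hsg ⊢
        refine ⟨hsg.1, fun c' hc' => ?_⟩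
        -- The facet lies in `x c = 0`, where labels are at most `c`, and it carries the label `k`;
        -- hence `k ≤ c`, and the coordinates beyond `k` are frozen.
        have hck : c = K := by
          have : k ∈ (Finset.range (k + 1)).image (g s) := by rw [him]; simp
          obtain ⟨j, hj, hj'⟩ := Finset.mem_image.1 this
          have hle := h0 (kuhnVertex s j) c (by
            simp only [kuhnVertex, hc, hc0]
            rw [if_neg]
            simp only [Finset.mem_range] at hj
            omega)
          have hle' : k ≤ c.val := hj' ▸ hle
          by_contra hne
          have : c.val ≠ k := fun h => hne (Fin.ext h)
          have := (hsg.2 c (by omega)).2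
          exact hne (this.symm.trans hc)
        rcases Nat.lt_or_ge k c'.val with h | h
        · exact hsg.2 c' h
        · have : c' = K := Fin.ext (by omega)
          rw [this]
          exact ⟨hck ▸ hc0, hck ▸ hc⟩
      · intro s hs
        obtain ⟨hsg, him⟩ := Finset.mem_filter.1 hs
        rw [Finset.mem_filter, hPmem]
        rw [mem_kuhnGrid] at hsg
        refine ⟨⟨⟨?_, by simp⟩, by rw [her]; exact him⟩, rfl, K, ?_⟩
        · rw [mem_kuhnGrid]
          exact ⟨hsg.1, fun c hc => hsg.2 c (by omega)⟩
        · exact ⟨(hsg.2 K le_rfl).2, (hsg.2 K le_rfl).1⟩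
      · rintro ⟨s, i⟩ hq
        obtain ⟨hqP, hi, -⟩ := Finset.mem_filter.1 hq
        dsimp only at hi
        rw [hi]
      · intro s _; rfl
    rw [hsum, ← Finset.card_filter_add_card_filter_not
      (fun q => q.2 = k + 1 ∧ ∃ c, q.1.2 c = K ∧ q.1.1 c = 0), Nat.cast_add, hrest, add_zero,
      hQcard]
    exact ih

end Sperner

/-! ### A discrete Poincaré–Miranda theorem. -/

section ApproximateZero

variable {d : ℕ}

theorem kuhnVertex_sub_le (s : (Fin d → ℕ) × Equiv.Perm (Fin d)) (j j' : ℕ) (c : Fin d) :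
    |(kuhnVertex s j c : ℤ) - kuhnVertex s j' c| ≤ 1 := by
  simp only [kuhnVertex]
  rw [abs_le]
  split_ifs <;> push_cast <;> constructor <;> linarith

/-- A discrete Poincaré–Miranda theorem: a map on `ℤ^d` with bounded increments which far away
from the origin has, at each point, a coordinate pointing strictly outwards, has an approximate
zero. -/
theorem exists_approx_zero (f : (Fin d → ℤ) → Fin d → ℤ) (C : ℤ) (R : ℕ)
    (hlip : ∀ p q : Fin d → ℤ, (∀ i, |p i - q i| ≤ 1) → ∀ i, |f p i - f q i| ≤ C)
    (hbd : ∀ p : Fin d → ℤ, (∃ i, (R : ℤ) ≤ |p i|) →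
      ∃ i, (0 < p i ∧ C < f p i) ∨ (p i < 0 ∧ f p i < -C)) :
    ∃ p, ∀ i, |f p i| ≤ C := by
  classical
  -- The grid covers `[-(R + 1), R + 1]^d`, so all grid points within distance 1 of a point of norm
  -- less than `R` are off its boundary.
  set m : ℕ := 2 * (R + 1) with hm
  set P : (Fin d → ℕ) → Fin d → ℤ := fun x c => (x c : ℤ) - (R + 1) with hP
  -- Away from the boundary `A c` says that component `c` of `f` is nonpositive. The clauses at `0`
  -- and `m` force Sperner's boundary conditions, with the least `c` satisfying `A c`, or else `d`,
  -- as label.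
  set A : Fin d → (Fin d → ℕ) → Prop :=
    fun c x => x c ≠ m ∧ (x c = 0 ∨ f (P x) c ≤ 0) with hA
  set ℓ : (Fin d → ℕ) → ℕ := fun x =>
    if h : ∃ n, ∃ hn : n < d, A ⟨n, hn⟩ x then Nat.find h else d with hℓ
  have hℓlt : ∀ x (c : Fin d), ℓ x = c.val → A c x := by
    intro x c hc
    by_cases h : ∃ n, ∃ hn : n < d, A ⟨n, hn⟩ x
    · simp only [hℓ, dif_pos h] at hc
      obtain ⟨hn, hx⟩ := Nat.find_spec h
      have : (⟨Nat.find h, hn⟩ : Fin d) = c := Fin.ext hc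
      rwa [this] at hx
    · simp only [hℓ, dif_neg h] at hc
      exact absurd hc c.2.ne'
  have hℓle : ∀ x (c : Fin d), A c x → ℓ x ≤ c.val := by
    intro x c hc
    have h : ∃ n, ∃ hn : n < d, A ⟨n, hn⟩ x := ⟨c.val, c.2, hc⟩
    simp only [hℓ, dif_pos h]
    exact Nat.find_min' h ⟨c.2, hc⟩
  have hℓd : ∀ x, ℓ x ≤ d := by
    intro x
    by_cases h : ∃ n, ∃ hn : n < d, A ⟨n, hn⟩ x
    · simp only [hℓ, dif_pos h]
      exact (Nat.find_spec h).1.le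
    · simp only [hℓ, dif_neg h, le_refl]
  have hcard := card_full_kuhnGrid (m := m) (by omega) ℓ hℓd
    (fun x c hx => hℓle x c ⟨by omega, Or.inl hx⟩)
    (fun x c hx h => (hℓlt x c h).1 hx) d le_rfl
  obtain ⟨s, hs⟩ : ((kuhnGrid d m d).filter fun s =>
      (Finset.range (d + 1)).image (fun j => ℓ (kuhnVertex s j)) =
        Finset.range (d + 1)).Nonempty := by
    rw [Finset.nonempty_iff_ne_empty]
    intro h
    rw [h] at hcard
    simp at hcard
  obtain ⟨hsg, him⟩ := Finset.mem_filter.1 hs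
  have hex : ∀ c : Fin d, ∃ j, A c (kuhnVertex s j) := by
    intro c
    have : c.val ∈ (Finset.range (d + 1)).image (fun j => ℓ (kuhnVertex s j)) := by
      rw [him]; simp
    obtain ⟨j, _, hj⟩ := Finset.mem_image.1 this
    exact ⟨j, hℓlt _ _ hj⟩
  obtain ⟨j', hj'⟩ : ∃ j, ∀ c, ¬ A c (kuhnVertex s j) := by
    have : d ∈ (Finset.range (d + 1)).image (fun j => ℓ (kuhnVertex s j)) := by
      rw [him]; simp
    obtain ⟨j, _, hj⟩ := Finset.mem_image.1 this
    refine ⟨j, fun c hc => ?_⟩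
    have := hℓle _ _ hc
    have := c.2
    omega
  have hclose : ∀ j i, |f (P (kuhnVertex s 0)) i - f (P (kuhnVertex s j)) i| ≤ C := by
    intro j
    refine hlip _ _ fun i => ?_
    have := kuhnVertex_sub_le s 0 j i
    simp only [hP]
    rwa [sub_sub_sub_cancel_right]
  have hclose' : ∀ j i, |P (kuhnVertex s 0) i - P (kuhnVertex s j) i| ≤ 1 := by
    intro j i
    simp only [hP]
    rw [sub_sub_sub_cancel_right]
    exact kuhnVertex_sub_le s 0 j i
  have hPdef : ∀ j i, P (kuhnVertex s j) i = (kuhnVertex s j i : ℤ) - (R + 1) := fun _ _ => rfl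
  refine ⟨P (kuhnVertex s 0), ?_⟩
  -- A full simplex has for each `i` a vertex satisfying `A i` and one satisfying no `A c`. Far out,
  -- the outward coordinate, whose component exceeds `C` in size, rules out one of the two; near the
  -- origin they give both signs and hence the bound `C`.
  by_cases hfar : ∃ i, (R : ℤ) ≤ |P (kuhnVertex s 0) i|
  · exfalso
    obtain ⟨i, ⟨h1, h2⟩ | ⟨h1, h2⟩⟩ := hbd _ hfar
    · obtain ⟨j, hj1, hj2⟩ := hex i
      have h3 := abs_le.1 (hclose j i)
      have h4 := abs_le.1 (hclose' j i)
      rw [hPdef j i] at h4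
      rcases hj2 with h | h
      · rw [h] at h4; push_cast at h4; omega
      · omega
    · refine hj' i ?_
      have h3 := abs_le.1 (hclose j' i)
      have h4 := abs_le.1 (hclose' j' i)
      rw [hPdef j' i] at h4
      exact ⟨by omega, Or.inr (by omega)⟩
  · push Not at hfar
    intro i
    have h0 := abs_lt.1 (hfar i)
    obtain ⟨j, hj1, hj2⟩ := hex i
    have h3 := abs_le.1 (hclose j i)
    have h4 := abs_le.1 (hclose' j i)
    have h5 := abs_le.1 (hclose j' i)
    have h6 := abs_le.1 (hclose' j' i)
    rw [hPdef j i] at h4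
    rw [hPdef j' i] at h6
    have h7 : f (P (kuhnVertex s j)) i ≤ 0 := by
      rcases hj2 with h | h
      · rw [h] at h4; push_cast at h4; omega
      · exact h
    have h8 : 0 < f (P (kuhnVertex s j')) i := by
      by_contra hcon
      exact hj' i ⟨by omega, Or.inr (by omega)⟩
    rw [abs_le]
    constructor <;> linarith

end ApproximateZero

/-! ### Hat functions on the boundary of a cube. -/

section SumsOfSignedPermutations

variable {d : ℕ}

/-- The largest positive part of a coordinate. -/
def supPos (y : Fin d → ℤ) : ℕ := Finset.univ.sup fun i => (y i).toNat

/-- The sup norm. -/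
def supNorm (y : Fin d → ℤ) : ℕ := Finset.univ.sup fun i => (y i).natAbs

theorem le_supPos (y : Fin d → ℤ) (i : Fin d) : y i ≤ supPos y := by
  have : (y i).toNat ≤ supPos y := Finset.le_sup (f := fun i => (y i).toNat) (Finset.mem_univ i)
  omega

theorem supPos_le {y : Fin d → ℤ} {B : ℕ} (h : ∀ i, y i ≤ B) : supPos y ≤ B :=
  Finset.sup_le fun i _ => by have := h i; omega

theorem abs_le_supNorm (y : Fin d → ℤ) (i : Fin d) : |y i| ≤ supNorm y := by
  have : (y i).natAbs ≤ supNorm y :=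
    Finset.le_sup (f := fun i => (y i).natAbs) (Finset.mem_univ i)
  rw [Int.abs_eq_natAbs]
  omega

theorem supNorm_le_iff {y : Fin d → ℤ} {B : ℕ} : supNorm y ≤ B ↔ ∀ i, |y i| ≤ B := by
  constructor
  · intro h i
    have := abs_le_supNorm y i
    omega
  · exact fun h => Finset.sup_le fun i _ => by
      have := h i
      rw [Int.abs_eq_natAbs] at this
      omega

theorem exists_abs_eq_supNorm (hd : 0 < d) (y : Fin d → ℤ) : ∃ i, |y i| = supNorm y := by
  obtain ⟨i, -, hi⟩ := Finset.exists_mem_eq_sup (Finset.univ : Finset (Fin d)) ⟨⟨0, hd⟩, by simp⟩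
    (fun i => (y i).natAbs)
  exact ⟨i, by rw [supNorm, hi, Int.abs_eq_natAbs]⟩

/-- Up to the factor `‖p‖`, the hat function of the vertex `u` in the Kuhn triangulation of the
boundary of `[-m, m]^d`, evaluated at the radial projection of `p`. -/
def hat (m : ℕ) (u p : Fin d → ℤ) : ℕ :=
  supNorm p - (supPos (fun i => m * p i - supNorm p * u i) +
    supPos (fun i => supNorm p * u i - m * p i))

/-- The norm changes by at most 1 and each `supPos` by at most `2 * m + 1`, whence `1 + 2 * (2 * m +
1)`. -/
theorem hat_le_add (m : ℕ) {u p q : Fin d → ℤ} (hu : ∀ i, |u i| ≤ m + 1)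
    (hpq : ∀ i, |p i - q i| ≤ 1) : hat m u p ≤ hat m u q + (4 * m + 3) := by
  have h1 : supNorm p ≤ supNorm q + 1 := supNorm_le_iff.2 fun i => by
    have := abs_le_supNorm q i
    have := abs_le.1 (hpq i)
    rw [abs_le] at *; push_cast; omega
  have h2 : supNorm q ≤ supNorm p + 1 := supNorm_le_iff.2 fun i => by
    have := abs_le_supNorm p i
    have := abs_le.1 (hpq i)
    rw [abs_le] at *; push_cast; omega
  have h3 : |(supNorm p : ℤ) - supNorm q| ≤ 1 := by rw [abs_le]; omega
  have h4 : ∀ i, |(m * p i - supNorm p * u i) - (m * q i - supNorm q * u i)| ≤ 2 * (m : ℤ) + 1 := by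
    intro i
    have e : (m * p i - supNorm p * u i) - (m * q i - supNorm q * u i) =
      m * (p i - q i) - ((supNorm p : ℤ) - supNorm q) * u i := by ring
    rw [e]
    refine (abs_sub _ _).trans ?_
    rw [abs_mul, abs_mul, Nat.abs_cast]
    have := mul_le_mul h3 (hu i) (abs_nonneg _) zero_le_one
    have := mul_le_mul_of_nonneg_left (hpq i) (Int.natCast_nonneg m)
    linarith
  have h5 : supPos (fun i => m * q i - supNorm q * u i) ≤
      supPos (fun i => m * p i - supNorm p * u i) + (2 * m + 1) := supPos_le fun i => by
    have := le_supPos (fun i => m * p i - supNorm p * u i) i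
    have := abs_le.1 (h4 i)
    push_cast; linarith
  have h6 : supPos (fun i => supNorm q * u i - m * q i) ≤
      supPos (fun i => supNorm p * u i - m * p i) + (2 * m + 1) := supPos_le fun i => by
    have := le_supPos (fun i => supNorm p * u i - m * p i) i
    have := abs_le.1 (h4 i)
    push_cast; linarith
  simp only [hat]
  omega

/-- After scaling, `p` lies in the open star of `u`. The second bound is what makes any two vertices
with positive hat comparable coordinatewise. -/
theorem of_hat_pos {m : ℕ} {u p : Fin d → ℤ} (h : 0 < hat m u p) :
    (∀ i, |m * p i - supNorm p * u i| < supNorm p) ∧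
      ∀ i k, (m * p i - supNorm p * u i) + (supNorm p * u k - m * p k) < supNorm p := by
  have h0 : supPos (fun i => m * p i - supNorm p * u i) +
    supPos (fun i => supNorm p * u i - m * p i) < supNorm p := by
    simp only [hat] at h; omega
  have h1 := le_supPos (fun i => m * p i - supNorm p * u i)
  have h2 := le_supPos (fun i => supNorm p * u i - m * p i)
  refine ⟨fun i => abs_lt.2 ⟨?_, ?_⟩, fun i k => ?_⟩
  · have := h2 i; omega
  · have := h1 i; omega
  · have := h1 i
    have := h2 k
    omega

theorem supNorm_pos_of_hat_pos {m : ℕ} {u p : Fin d → ℤ} (h : 0 < hat m u p) : 0 < supNorm p := by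
  simp only [hat] at h; omega

/-- Pigeonhole: `d` values cannot meet all of `d + 1` disjoint intervals of length `s`. -/
theorem exists_gap (v : Fin d → ℤ) (s : ℤ) (hs : 0 < s) :
    ∃ k ≤ d, ∀ i, v i < k * s ∨ (k + 1) * s ≤ v i := by
  by_contra! hcon
  choose g hg1 hg2 using hcon
  obtain ⟨a, b, hab, hgab⟩ := Fintype.exists_ne_map_eq_of_card_lt
    (fun k : Fin (d + 1) => g k.val (Nat.lt_succ_iff.1 k.2)) (by simp)
  have ha1 := hg1 a.val (by omega)
  have ha2 := hg2 a.val (by omega)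
  have hb1 := hg1 b.val (by omega)
  have hb2 := hg2 b.val (by omega)
  rw [← hgab] at hb1 hb2
  have h1 : (a.val : ℤ) < b.val + 1 := lt_of_mul_lt_mul_right (ha1.trans_lt hb2) hs.le
  have h2 : (b.val : ℤ) < a.val + 1 := lt_of_mul_lt_mul_right (hb1.trans_lt ha2) hs.le
  exact hab (Fin.ext (by omega))

/-- The fractional parts of `m * p i / r` avoid some interval `[k / (d + 1), (k + 1) / (d + 1))`.
Rounding down below it and up above it gives positive and negative errors at most `k / (d + 1)` and
`(d - k) / (d + 1)`, so at least `1 / (d + 1)` is left for the hat. -/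
theorem exists_hat_ge (m : ℕ) (p : Fin d → ℤ) (hp : 0 < supNorm p) :
    ∃ u : Fin d → ℤ, (∀ i, |u i| ≤ m + 1) ∧ supNorm p ≤ (d + 1) * hat m u p := by
  set r := supNorm p with hr
  have hr' : (0 : ℤ) < r := by exact_mod_cast hp
  obtain ⟨k, hk, hgap⟩ := exists_gap (fun i => (d + 1) * ((m * p i) % (r : ℤ))) r hr'
  have hk' : (k : ℤ) ≤ d := by exact_mod_cast hk
  set u : Fin d → ℤ := fun i =>
    (m * p i) / (r : ℤ) + if (d + 1) * ((m * p i) % (r : ℤ)) < k * r then 0 else 1 with hu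
  have hyu : ∀ i, m * p i - r * u i = (m * p i) % (r : ℤ) -
      if (d + 1) * ((m * p i) % (r : ℤ)) < k * r then 0 else (r : ℤ) := by
    intro i
    have := Int.emod_add_mul_ediv (m * p i) (r : ℤ)
    simp only [hu]
    split_ifs <;> linarith
  have hub : ∀ i, (d + 1) * (m * p i - r * u i) ≤ k * (r : ℤ) := by
    intro i
    rw [hyu]
    have h1 := Int.emod_lt_of_pos (m * p i) hr'
    have h2 : 0 ≤ (k : ℤ) * r := by positivity
    split_ifs with h
    · linarith
    · nlinarith
  have hlb : ∀ i, (d + 1) * (r * u i - m * p i) ≤ (d - k) * (r : ℤ) := by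
    intro i
    have h1 := Int.emod_nonneg (m * p i) hr'.ne'
    have h2 : 0 ≤ ((d : ℤ) - k) * r := mul_nonneg (by linarith) hr'.le
    have h3 := hyu i
    split_ifs at h3 with h
    · nlinarith
    · rcases hgap i with h4 | h4
      · exact absurd h4 h
      · nlinarith
  refine ⟨u, fun i => ?_, ?_⟩
  · have h1 := Int.emod_lt_of_pos (m * p i) hr'
    have h2 := Int.emod_nonneg (m * p i) hr'.ne'
    have h3 := abs_le.1 (abs_le_supNorm p i)
    rw [← hr] at h3
    have h4 := hyu i
    have h5 : |m * p i - r * u i| ≤ r := by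
      rw [h4, abs_le]; split_ifs <;> constructor <;> linarith
    have h6 := abs_le.1 h5
    have h7 : (m : ℤ) * p i ≤ m * r := mul_le_mul_of_nonneg_left h3.2 (by positivity)
    have h8 : -((m : ℤ) * r) ≤ m * p i := by
      have := mul_le_mul_of_nonneg_left h3.1 (Int.natCast_nonneg m); linarith
    rw [abs_le]
    constructor <;> refine le_of_mul_le_mul_left ?_ hr' <;> linarith
  · obtain ⟨B, hB⟩ : ∃ B, B = supPos (fun i => m * p i - r * u i) := ⟨_, rfl⟩
    obtain ⟨B', hB'⟩ : ∃ B, B = supPos (fun i => r * u i - m * p i) := ⟨_, rfl⟩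
    have hBk : (d + 1) * B ≤ k * r := by
      rcases Nat.eq_zero_or_pos d with hd | hd
      · subst hd; simp [hB, supPos]
      · obtain ⟨i, -, hi⟩ := Finset.exists_mem_eq_sup (Finset.univ : Finset (Fin d))
          ⟨⟨0, hd⟩, by simp⟩ (fun i => (m * p i - r * u i).toNat)
        rw [← supPos, ← hB] at hi
        rcases le_total (m * p i - r * u i) 0 with h | h
        · rw [hi, Int.toNat_of_nonpos h]; simp
        · have := hub i
          rw [← Int.toNat_of_nonneg h, ← hi] at this
          exact_mod_cast this
    have hBk' : (d + 1) * B' ≤ (d - k) * r := by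
      rcases Nat.eq_zero_or_pos d with hd | hd
      · subst hd; simp [hB', supPos]
      · obtain ⟨i, -, hi⟩ := Finset.exists_mem_eq_sup (Finset.univ : Finset (Fin d))
          ⟨⟨0, hd⟩, by simp⟩ (fun i => (r * u i - m * p i).toNat)
        rw [← supPos, ← hB'] at hi
        rcases le_total (r * u i - m * p i) 0 with h | h
        · rw [hi, Int.toNat_of_nonpos h]; simp
        · have := hlb i
          rw [← Int.toNat_of_nonneg h, ← hi, ← Nat.cast_sub hk] at this
          exact_mod_cast this
    have hsum : (d + 1) * (B + B') ≤ d * r := by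
      calc (d + 1) * (B + B') ≤ k * r + (d - k) * r := by rw [mul_add]; omega
        _ = d * r := by rw [← add_mul]; congr 1; omega
    rw [hat, ← hr, ← hB, ← hB', Nat.mul_sub]
    rw [add_mul, one_mul]
    omega

/-- The vertices with positive hat form a chain, differ by at most 1 in each coordinate, and agree
in a coordinate where `|p j|` is maximal, since `m * p j / r = ± m` there is an integer. Their
coordinate sums are thus distinct and lie in an interval of `d` integers. -/
theorem card_hat_support_le (hd : 0 < d) (m : ℕ) (p : Fin d → ℤ) (U : Finset (Fin d → ℤ))
    (hU : ∀ u ∈ U, 0 < hat m u p) : U.card ≤ d := by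
  rcases U.eq_empty_or_nonempty with rfl | hne
  · simp
  obtain ⟨u₁, hu₁⟩ := hne
  have hr : (0 : ℤ) < supNorm p := by exact_mod_cast supNorm_pos_of_hat_pos (hU u₁ hu₁)
  set r := supNorm p with hrdef
  have hcomp : ∀ u ∈ U, ∀ u' ∈ U, ∀ i k, u i < u' i → u' k < u k → False := by
    intro u hu u' hu' i k h1 h2
    have h3 := (of_hat_pos (hU u hu)).2 i k
    have h4 := (of_hat_pos (hU u' hu')).2 k i
    rw [← hrdef] at h3 h4
    have h5 : (r : ℤ) * (u i + 1) ≤ r * u' i := mul_le_mul_of_nonneg_left h1 hr.le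
    have h6 : (r : ℤ) * (u' k + 1) ≤ r * u k := mul_le_mul_of_nonneg_left h2 hr.le
    linarith
  have hone : ∀ u ∈ U, ∀ u' ∈ U, ∀ i, u' i ≤ u i + 1 := by
    intro u hu u' hu' i
    have h3 := abs_lt.1 ((of_hat_pos (hU u hu)).1 i)
    have h4 := abs_lt.1 ((of_hat_pos (hU u' hu')).1 i)
    rw [← hrdef] at h3 h4
    have : u' i < u i + 2 := lt_of_mul_lt_mul_left (a := (r : ℤ)) (by linarith) hr.le
    omega
  obtain ⟨j, hj⟩ := exists_abs_eq_supNorm hd p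
  have hfix : ∀ u ∈ U, ∀ u' ∈ U, u' j = u j := by
    have hval : ∀ u ∈ U, ∀ e : ℤ, p j = e * r → u j = m * e := by
      intro u hu e he
      have h3 := abs_lt.1 ((of_hat_pos (hU u hu)).1 j)
      rw [← hrdef, he] at h3
      have h4 : (m : ℤ) * e - u j < 1 := lt_of_mul_lt_mul_left (a := (r : ℤ)) (by linarith) hr.le
      have h5 : -1 < (m : ℤ) * e - u j := lt_of_mul_lt_mul_left (a := (r : ℤ)) (by linarith) hr.le
      omega
    intro u hu u' hu'
    rw [← hrdef] at hj
    rcases (abs_eq hr.le).1 hj with h | h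
    · rw [hval u hu 1 (by linarith), hval u' hu' 1 (by linarith)]
    · rw [hval u hu (-1) (by linarith), hval u' hu' (-1) (by linarith)]
  have hle : ∀ u ∈ U, ∀ u' ∈ U, ∑ i, u' i ≤ ∑ i, u i + (d - 1) := by
    intro u hu u' hu'
    have h1 : ∑ i ∈ Finset.univ.erase j, u' i ≤ ∑ i ∈ Finset.univ.erase j, (u i + 1) :=
      Finset.sum_le_sum fun i _ => hone u hu u' hu' i
    rw [Finset.sum_add_distrib] at h1
    rw [← Finset.add_sum_erase _ _ (Finset.mem_univ j),
      ← Finset.add_sum_erase _ (fun i => u i) (Finset.mem_univ j), hfix u hu u' hu']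
    have : ∑ i ∈ Finset.univ.erase j, (1 : ℤ) = d - 1 := by
      rw [Finset.sum_const, Finset.card_erase_of_mem (Finset.mem_univ j), Finset.card_univ,
        Fintype.card_fin, nsmul_eq_mul, mul_one, Nat.cast_sub hd, Nat.cast_one]
    linarith
  have hinj : Set.InjOn (fun u : Fin d → ℤ => ∑ i, u i) U := by
    have key : ∀ u ∈ U, ∀ u' ∈ U, ∑ i, u i = ∑ i, u' i → ∀ i, ¬ u i < u' i := by
      intro u hu u' hu' hsum i hi
      have : ∑ i, u i < ∑ i, u' i := Finset.sum_lt_sum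
        (fun k _ => not_lt.1 fun hk => hcomp u hu u' hu' i k hi hk) ⟨i, Finset.mem_univ i, hi⟩
      exact absurd hsum this.ne
    intro u hu u' hu' hsum
    funext i
    have h1 := key u hu u' hu' hsum i
    have h2 := key u' hu' u hu hsum.symm i
    omega
  obtain ⟨u₀, hu₀, hmin⟩ := Finset.exists_min_image U (fun u => ∑ i, u i) ⟨u₁, hu₁⟩
  have := Finset.card_le_card_of_injOn (t := Finset.Icc (∑ i, u₀ i) (∑ i, u₀ i + (d - 1)))
    (fun u : Fin d → ℤ => ∑ i, u i) (fun u hu => by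
      simp only [Finset.coe_Icc, Set.mem_Icc]
      exact ⟨hmin u hu, hle u₀ hu₀ u hu⟩) hinj
  rw [Int.card_Icc] at this
  omega

end SumsOfSignedPermutations

/-! ### Sums of curve points aligned with the vertices. -/

section SumsOfSignedPermutations

variable {d : ℕ}

/-- Ranks the coordinates by decreasing absolute value. -/
def absRank (u : Fin d → ℤ) : Equiv.Perm (Fin d) := (Tuple.sort fun i => -|u i|).symm

theorem absRank_lt {u : Fin d → ℤ} {i j : Fin d} (h : |u j| < |u i|) :
    absRank u i < absRank u j := by
  by_contra hcon
  have := Tuple.monotone_sort (fun i => -|u i|) (not_lt.1 hcon)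
  simp only [absRank, Function.comp_apply, Equiv.apply_symm_apply] at this
  linarith

/-- The vector `v` with coordinates permuted and signed as those of `u`. -/
def alignTo (u v : Fin d → ℤ) : Fin d → ℤ :=
  fun i => (if u i < 0 then -1 else 1) * v (absRank u i)

theorem abs_alignTo (u v : Fin d → ℤ) (i : Fin d) : |alignTo u v i| = |v (absRank u i)| := by
  simp only [alignTo]; split_ifs <;> simp

/-- `I` collects the coordinates where `|m * p i|` lies above a gap of width `3 * r`. Each active
`u` is within distance 1 of `m * p / r`, so it keeps the signs on `I` and the strict separation of
`I` from its complement. The choice `m = 3 * (d + 1)` puts the maximal coordinate above every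
possible gap. -/
theorem exists_face (hd : 0 < d) (p : Fin d → ℤ) (hp : 0 < supNorm p) :
    ∃ I : Finset (Fin d), I.Nonempty ∧ (∀ i ∈ I, p i ≠ 0) ∧
      ∀ u : Fin d → ℤ, 0 < hat (3 * (d + 1)) u p →
        (∀ i ∈ I, (0 < p i → 0 < u i) ∧ (p i < 0 → u i < 0)) ∧
        ∀ i ∈ I, ∀ j ∉ I, |u j| < |u i| := by
  set r := supNorm p with hrdef
  set m := 3 * (d + 1) with hm
  have hr : (0 : ℤ) < r := by exact_mod_cast hp
  obtain ⟨k, hk, hgap⟩ := exists_gap (fun i => |(m : ℤ) * p i|) (3 * r) (by linarith)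
  have hk' : (k : ℤ) ≤ d := by exact_mod_cast hk
  have hin : ∀ i, ((k : ℤ) + 1) * (3 * r) ≤ |(m : ℤ) * p i| → p i ≠ 0 := by
    intro i hi h0
    rw [h0, mul_zero, abs_zero] at hi
    have : (0 : ℤ) < (k + 1) * (3 * r) := by positivity
    linarith
  refine ⟨Finset.univ.filter fun i => ((k : ℤ) + 1) * (3 * r) ≤ |(m : ℤ) * p i|, ?_, ?_, ?_⟩
  · obtain ⟨j, hj⟩ := exists_abs_eq_supNorm hd p
    refine ⟨j, Finset.mem_filter.2 ⟨Finset.mem_univ j, ?_⟩⟩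
    rw [abs_mul, hj, ← hrdef, Nat.abs_cast, hm]
    push_cast
    nlinarith
  · intro i hi
    exact hin i (Finset.mem_filter.1 hi).2
  · intro u hu
    have hclose := (of_hat_pos hu).1
    rw [← hrdef] at hclose
    have hbig : ∀ i, ((k : ℤ) + 1) * (3 * r) ≤ |(m : ℤ) * p i| → 3 * (k : ℤ) + 2 < |u i| := by
      intro i hi
      have h1 : |(m : ℤ) * p i| - |(r : ℤ) * u i| ≤ |m * p i - r * u i| :=
        abs_sub_abs_le_abs_sub _ _
      have h2 := hclose i
      rw [abs_mul (r : ℤ), Nat.abs_cast] at h1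
      refine lt_of_mul_lt_mul_left (a := (r : ℤ)) ?_ hr.le
      linarith
    have hsmall : ∀ i, |(m : ℤ) * p i| < k * (3 * r) → |u i| < 3 * (k : ℤ) + 1 := by
      intro i hi
      have h1 : |(r : ℤ) * u i| - |(m : ℤ) * p i| ≤ |r * u i - m * p i| :=
        abs_sub_abs_le_abs_sub _ _
      have h2 := hclose i
      rw [abs_mul (r : ℤ), Nat.abs_cast, abs_sub_comm] at h1
      refine lt_of_mul_lt_mul_left (a := (r : ℤ)) ?_ hr.le
      linarith
    refine ⟨fun i hi => ?_, fun i hi j hj => ?_⟩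
    · have hi' := (Finset.mem_filter.1 hi).2
      have h2 := abs_lt.1 (hclose i)
      have h3 : (0 : ℤ) ≤ k * (3 * r) := by positivity
      have hm0 : (0 : ℤ) ≤ m := Int.natCast_nonneg m
      constructor
      · intro hpos
        rw [abs_of_nonneg (mul_nonneg hm0 hpos.le)] at hi'
        refine pos_of_mul_pos_right (a := (r : ℤ)) ?_ hr.le
        linarith
      · intro hneg
        rw [abs_of_nonpos (mul_nonpos_of_nonneg_of_nonpos hm0 hneg.le)] at hi'
        have : 0 < (r : ℤ) * -u i := by linarith
        have := pos_of_mul_pos_right this hr.le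
        linarith
    · have hi' := hbig i (Finset.mem_filter.1 hi).2
      have hj' : ¬ ((k : ℤ) + 1) * (3 * r) ≤ |(m : ℤ) * p j| := fun h =>
        hj (Finset.mem_filter.2 ⟨Finset.mem_univ j, h⟩)
      have := hsmall j ((hgap j).resolve_right hj')
      linarith

/-- Let `γ` be a discrete curve in the chamber `v₁ ≥ … ≥ v_d ≥ 0` from the origin to the wall
`v₁ = N`. Up to a bounded error, every vector of norm smaller than `N` is a sum of at most `d`
vectors obtained from points of `γ` by permuting and signing coordinates, and the partial sums are
bounded. -/
theorem exists_sum_signed_perms (hd : 0 < d) :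
    ∃ C : ℕ, ∀ n N : ℕ, n + C < N → ∀ γ : ℕ → Fin d → ℤ, γ 0 = 0 →
      (∀ t i, |γ (t + 1) i - γ t i| ≤ 1) → (∀ t i, 0 ≤ γ t i) → (∀ t, Antitone (γ t)) →
      (∃ L, ∀ t, L ≤ t → γ t ⟨0, hd⟩ = N) → ∀ z : Fin d → ℤ, (∀ i, |z i| ≤ n) →
      ∃ (U : Finset (Fin d → ℤ)) (w : (Fin d → ℤ) → Fin d → ℤ), U.card ≤ d ∧
        (∀ u, ∃ t, ∃ ρ : Equiv.Perm (Fin d), ∀ i, |w u i| = |γ t (ρ i)|) ∧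
        (∀ U' ⊆ U, ∀ i, |∑ u ∈ U', w u i| ≤ (n + C : ℕ)) ∧
        ∀ i, |∑ u ∈ U, w u i - z i| ≤ C := by
  classical
  set m := 3 * (d + 1) with hm
  set B : Finset (Fin d → ℤ) :=
    Fintype.piFinset fun _ => Finset.Icc (-((m : ℤ) + 1)) ((m : ℤ) + 1) with hB
  have hBmem : ∀ u, u ∈ B ↔ ∀ i, |u i| ≤ m + 1 := by
    intro u
    simp only [hB, Fintype.mem_piFinset, Finset.mem_Icc, abs_le]
  -- Each hat function moves by at most `4 * m + 3` under a unit displacement and `γ` has unit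
  -- speed; `C` sums this over all vertices.
  refine ⟨B.card * (4 * m + 3), fun n N hN γ hγ0 hγ1 hγnn hγanti hγN z hz => ?_⟩
  set C := B.card * (4 * m + 3) with hC
  have hγlip : ∀ s t i, |γ (s + t) i - γ s i| ≤ t := by
    intro s t i
    induction t with
    | zero => simp
    | succ t ih =>
      have := abs_le.1 (hγ1 (s + t) i)
      have := abs_le.1 ih
      rw [abs_le]
      push_cast
      rw [← add_assoc]
      constructor <;> linarith
  set W : (Fin d → ℤ) → (Fin d → ℤ) → Fin d → ℤ := fun p u => alignTo u (γ (hat m u p)) with hW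
  set f : (Fin d → ℤ) → Fin d → ℤ := fun p i => ∑ u ∈ B, W p u i with hf
  have hW0 : ∀ p u, ¬ 0 < hat m u p → W p u = 0 := by
    intro p u h
    funext i
    simp only [hW, alignTo]
    rw [Nat.eq_zero_of_not_pos h, hγ0]
    simp
  have hlip : ∀ p q : Fin d → ℤ, (∀ i, |p i - q i| ≤ 1) → ∀ i, |f p i - f q i| ≤ C := by
    intro p q hpq i
    have hterm : ∀ u ∈ B, |W p u i - W q u i| ≤ (4 * m + 3 : ℕ) := by
      intro u hu
      have h1 := hat_le_add m ((hBmem u).1 hu) hpq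
      have h2 := hat_le_add m ((hBmem u).1 hu) (p := q) (q := p)
        (fun i => by rw [abs_sub_comm]; exact hpq i)
      have h3 : |W p u i - W q u i| =
          |γ (hat m u p) (absRank u i) - γ (hat m u q) (absRank u i)| := by
        simp only [hW, alignTo, ← mul_sub, abs_mul]
        split_ifs <;> simp
      rw [h3]
      rcases le_total (hat m u p) (hat m u q) with h | h
      · obtain ⟨t, ht⟩ := Nat.exists_eq_add_of_le h
        rw [ht, abs_sub_comm]
        exact (hγlip _ _ _).trans (by exact_mod_cast (by omega))
      · obtain ⟨t, ht⟩ := Nat.exists_eq_add_of_le h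
        rw [ht]
        exact (hγlip _ _ _).trans (by exact_mod_cast (by omega))
    simp only [hf, ← Finset.sum_sub_distrib]
    refine (Finset.abs_sum_le_sum_abs _ _).trans ((Finset.sum_le_sum hterm).trans ?_)
    rw [Finset.sum_const, nsmul_eq_mul, hC]
    push_cast
    exact le_rfl
  have hface : ∀ p, 0 < supNorm p → ∃ I : Finset (Fin d), I.Nonempty ∧ (∀ i ∈ I, p i ≠ 0) ∧
      (∀ u, 0 < hat m u p → ∀ i ∈ I, ∀ j ∉ I, |u j| < |u i|) ∧
      (∀ u, ∀ i ∈ I, W p u i * (if p i < 0 then -1 else 1) = |W p u i|) ∧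
      ∀ u, ∀ i ∈ I, ∀ j ∉ I, |W p u j| ≤ |W p u i| := by
    intro p hp
    obtain ⟨I, hI, hIp, hIu⟩ := exists_face hd p hp
    refine ⟨I, hI, hIp, fun u hu => (hIu u hu).2, fun u i hi => ?_, fun u i hi j hj => ?_⟩
    · by_cases hu : 0 < hat m u p
      · have h1 := (hIu u hu).1 i hi
        rw [abs_alignTo, abs_of_nonneg (hγnn _ _)]
        simp only [hW, alignTo]
        rcases lt_trichotomy (p i) 0 with h | h | h
        · rw [if_pos h, if_pos (h1.2 h)]; ring
        · exact absurd h (hIp i hi)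
        · rw [if_neg (not_lt.2 h.le), if_neg (not_lt.2 (h1.1 h).le)]; ring
      · simp [hW0 p u hu]
    · by_cases hu : 0 < hat m u p
      · rw [abs_alignTo, abs_alignTo, abs_of_nonneg (hγnn _ _), abs_of_nonneg (hγnn _ _)]
        exact hγanti _ (absRank_lt ((hIu u hu).2 i hi j hj)).le
      · simp [hW0 p u hu]
  have hsumabs : ∀ p, ∀ U' ⊆ B, ∀ i, (∀ u, W p u i * (if p i < 0 then -1 else 1) = |W p u i|) →
      ∑ u ∈ U', |W p u i| ≤ f p i * (if p i < 0 then -1 else 1) := by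
    intro p U' hU' i hi
    simp only [hf, Finset.sum_mul, hi]
    exact Finset.sum_le_sum_of_subset_of_nonneg hU' fun _ _ _ => abs_nonneg _
  obtain ⟨L, hL⟩ := hγN
  -- At this radius `exists_hat_ge` gives a vertex whose hat exceeds `L`, so its copy of `γ` has
  -- reached the wall.
  obtain ⟨p, hp⟩ := exists_approx_zero (fun p i => f p i - z i) C ((d + 1) * (L + 1))
    (fun p q hpq i => by
      rw [sub_sub_sub_cancel_right]; exact hlip p q hpq i)
    (by
      rintro p ⟨i, hi⟩
      have hr : (d + 1) * (L + 1) ≤ supNorm p := by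
        have := abs_le_supNorm p i
        exact_mod_cast hi.trans this
      have hr0 : 0 < supNorm p := lt_of_lt_of_le (by positivity) hr
      obtain ⟨I, ⟨i₀, hi₀⟩, hIp, hIu, hIs, -⟩ := hface p hr0
      obtain ⟨u, hu, hur⟩ := exists_hat_ge m p hr0
      have hLu : L + 1 ≤ hat m u p := Nat.le_of_mul_le_mul_left (hr.trans hur) (by omega)
      -- The coordinate in which `u` receives the largest entry `N` of its curve point. It must lie
      -- in `I`, where the summands do not cancel.
      set j := (absRank u).symm ⟨0, hd⟩ with hj
      have hjI : j ∈ I := by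
        by_contra hcon
        have := absRank_lt (hIu u (by omega) i₀ hi₀ j hcon)
        rw [hj, Equiv.apply_symm_apply] at this
        exact absurd this (by simp [Fin.lt_def])
      have h1 := hsumabs p {u} (by simpa [hBmem] using hu) j (fun u => hIs u j hjI)
      rw [Finset.sum_singleton, abs_alignTo, hj, Equiv.apply_symm_apply, hL _ (by omega),
        Nat.abs_cast, ← hj] at h1
      have h2 := abs_le.1 (hz j)
      have hN' : (n : ℤ) + C < N := by exact_mod_cast hN
      refine ⟨j, ?_⟩
      rcases lt_trichotomy (p j) 0 with h | h | h
      · rw [if_pos h] at h1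
        exact Or.inr ⟨h, by linarith⟩
      · exact absurd h (hIp j hjI)
      · rw [if_neg (not_lt.2 h.le)] at h1
        exact Or.inl ⟨h, by linarith⟩)
  have hfle : ∀ i, |f p i| ≤ n + C := by
    intro i
    have := abs_le.1 (hp i)
    have := abs_le.1 (hz i)
    rw [abs_le]; constructor <;> linarith
  set U := B.filter fun u => 0 < hat m u p with hU
  have hUsum : ∀ i, ∑ u ∈ U, W p u i = f p i := by
    intro i
    simp only [hf]
    refine Finset.sum_subset (Finset.filter_subset _ _) fun u hu hu' => ?_
    rw [hW0 p u fun h => hu' (Finset.mem_filter.2 ⟨hu, h⟩)]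
    rfl
  refine ⟨U, W p, card_hat_support_le hd m p U fun u hu => (Finset.mem_filter.1 hu).2,
    fun u => ⟨hat m u p, absRank u, fun i => abs_alignTo _ _ _⟩, fun U' hU' j => ?_, fun i => ?_⟩
  · refine (Finset.abs_sum_le_sum_abs _ _).trans ?_
    push_cast
    rcases Nat.eq_zero_or_pos (supNorm p) with h0 | h0
    · rw [Finset.sum_eq_zero fun u hu => ?_]
      · positivity
      · have := (Finset.mem_filter.1 (hU' hu)).2
        have := supNorm_pos_of_hat_pos this
        omega
    -- On `I` all summands have the sign of `p`, so partial sums are dominated by the full sum; off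
    -- `I` each summand is dominated by its entry at `i₀`.
    · obtain ⟨I, ⟨i₀, hi₀⟩, hIp, hIu, hIs, hIo⟩ := hface p h0
      have hle : ∀ i ∈ I, ∑ u ∈ U', |W p u i| ≤ n + C := by
        intro i hi
        refine (hsumabs p U' (hU'.trans (Finset.filter_subset _ _)) i fun u => hIs u i hi).trans ?_
        refine (le_abs_self _).trans ?_
        rw [abs_mul]
        refine le_trans (le_of_eq ?_) (hfle i)
        split_ifs <;> simp
      by_cases hj : j ∈ I
      · exact hle j hj
      · exact (Finset.sum_le_sum fun u _ => hIo u i₀ hi₀ j hj).trans (hle i₀ hi₀)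
  · rw [hUsum]; exact hp i

end SumsOfSignedPermutations

/-! ### Open paths and the symmetries of the lattice. -/

section Connectivity

variable {d : ℕ}

theorem connectedIn_iff {Γ ω : Set (Fin d → ℤ)} {x y : Fin d → ℤ} :
    ConnectedIn Γ x y ω ↔ x ∈ ω ∩ Γ ∧
      Relation.ReflTransGen (fun a b => (latticeGraph d).Adj a b ∧ b ∈ ω ∩ Γ) x y := by
  constructor
  · rintro ⟨w, hw⟩
    induction w with
    | nil => exact ⟨hw _ (by simp), .refl⟩
    | cons h w ih =>
      have h1 := ih fun v hv => hw v (by simp [hv])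
      exact ⟨hw _ (by simp), .head ⟨h, h1.1⟩ h1.2⟩
  · rintro ⟨hx, h⟩
    induction h with
    | refl => exact ⟨.nil, fun v hv => by simp at hv; rwa [hv]⟩
    | tail _ hab ih =>
      obtain ⟨w, hw⟩ := ih
      refine ⟨w.concat hab.1, fun v hv => ?_⟩
      rw [SimpleGraph.Walk.support_concat, List.mem_append,
        List.mem_singleton] at hv
      rcases hv with hv | rfl
      · exact hw v hv
      · exact hab.2

theorem ConnectedIn.left_mem {Γ ω : Set (Fin d → ℤ)} {x y : Fin d → ℤ}
    (h : ConnectedIn Γ x y ω) : x ∈ ω ∩ Γ := (connectedIn_iff.1 h).1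

theorem ConnectedIn.right_mem {Γ ω : Set (Fin d → ℤ)} {x y : Fin d → ℤ}
    (h : ConnectedIn Γ x y ω) : y ∈ ω ∩ Γ := h.elim fun w hw => hw y w.end_mem_support

theorem ConnectedIn.refl {Γ ω : Set (Fin d → ℤ)} {x : Fin d → ℤ} (h : x ∈ ω ∩ Γ) :
    ConnectedIn Γ x x ω := connectedIn_iff.2 ⟨h, .refl⟩

theorem ConnectedIn.trans {Γ ω : Set (Fin d → ℤ)} {x y z : Fin d → ℤ}
    (h : ConnectedIn Γ x y ω) (h' : ConnectedIn Γ y z ω) : ConnectedIn Γ x z ω :=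
  connectedIn_iff.2 ⟨h.left_mem, (connectedIn_iff.1 h).2.trans (connectedIn_iff.1 h').2⟩

theorem ConnectedIn.tail {Γ ω : Set (Fin d → ℤ)} {x y z : Fin d → ℤ}
    (h : ConnectedIn Γ x y ω) (hyz : (latticeGraph d).Adj y z) (hz : z ∈ ω ∩ Γ) :
    ConnectedIn Γ x z ω :=
  connectedIn_iff.2 ⟨h.left_mem, (connectedIn_iff.1 h).2.tail ⟨hyz, hz⟩⟩

theorem ConnectedIn.mono {Γ Γ' ω ω' : Set (Fin d → ℤ)} {x y : Fin d → ℤ}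
    (h : ConnectedIn Γ x y ω) (hω : ω ∩ Γ ⊆ ω' ∩ Γ') : ConnectedIn Γ' x y ω' :=
  h.imp fun _ hw v hv => hω (hw v hv)

theorem ConnectedIn.induction_on {Γ ω : Set (Fin d → ℤ)} {x : Fin d → ℤ} {P : (Fin d → ℤ) → Prop}
    {y : Fin d → ℤ} (h : ConnectedIn Γ x y ω) (h0 : P x)
    (hstep : ∀ a b, ConnectedIn Γ x a ω → P a → (latticeGraph d).Adj a b → b ∈ ω ∩ Γ → P b) :
    P y := by
  obtain ⟨hx, h⟩ := connectedIn_iff.1 h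
  induction h with
  | refl => exact h0
  | tail hxa hab ih =>
    have h' := connectedIn_iff.2 ⟨hx, hxa⟩
    exact hstep _ _ h' (ih h') hab.1 hab.2

theorem determinedBy_connectedIn (Γ : Set (Fin d → ℤ)) (x y : Fin d → ℤ) :
    DeterminedBy Γ {ω | ConnectedIn Γ x y ω} := fun _ _ h =>
  ⟨fun hc => hc.mono h.subset, fun hc => hc.mono h.symm.subset⟩

theorem isUpperSet_connectedIn (Γ : Set (Fin d → ℤ)) (x y : Fin d → ℤ) :
    IsUpperSet {ω | ConnectedIn Γ x y ω} := fun _ _ h hc =>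
  ConnectedIn.mono hc (Set.inter_subset_inter_left Γ h)

theorem connectedIn_preimage {Γ ω : Set (Fin d → ℤ)} {x y : Fin d → ℤ}
    (e : latticeGraph d ≃g latticeGraph d) :
    ConnectedIn Γ x y (e ⁻¹' ω) ↔ ConnectedIn (e '' Γ) (e x) (e y) ω := by
  have key : ∀ (e : latticeGraph d ≃g latticeGraph d) (Γ ω : Set (Fin d → ℤ)) (x y : Fin d → ℤ),
      ConnectedIn Γ x y (e ⁻¹' ω) → ConnectedIn (e '' Γ) (e x) (e y) ω := by
    rintro e Γ ω x y ⟨w, hw⟩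
    refine ⟨w.map e.toHom, fun v hv => ?_⟩
    rw [SimpleGraph.Walk.support_map, List.mem_map] at hv
    obtain ⟨u, hu, rfl⟩ := hv
    exact ⟨(hw u hu).1, u, (hw u hu).2, rfl⟩
  refine ⟨key e Γ ω x y, fun h => ?_⟩
  have h2 := key e.symm (e '' Γ) (e ⁻¹' ω) (e x) (e y) (by
    convert h using 1
    ext v; simp)
  have h3 : e.symm '' (e '' Γ) = Γ := by
    rw [Set.image_image]; simp
  rw [h3] at h2
  simpa using h2

/-- Invariance of connection probabilities under automorphisms of the lattice. -/
theorem measureReal_connectedIn_image (p : unitInterval) (F : Finset (Fin d → ℤ))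
    (e : latticeGraph d ≃g latticeGraph d) (x y : Fin d → ℤ) :
    (siteMeasure d p).real {ω | ConnectedIn (e '' (F : Set (Fin d → ℤ))) (e x) (e y) ω} =
      (siteMeasure d p).real {ω | ConnectedIn (F : Set (Fin d → ℤ)) x y ω} := by
  rw [siteMeasure, ← measureReal_preimage_image p F e.toEquiv (determinedBy_connectedIn _ x y)]
  congr 1
  ext ω
  exact (connectedIn_preimage e).symm

/-- Translations of the lattice. -/
def translate (v : Fin d → ℤ) : latticeGraph d ≃g latticeGraph d where
  toEquiv := Equiv.addLeft v
  map_rel_iff' := by intro a b; simp [latticeGraph]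

@[simp] theorem translate_apply (v x : Fin d → ℤ) : translate v x = v + x := rfl

/-- Signed permutations of the coordinates. -/
def signedPerm (s : Fin d → ℤˣ) (π : Equiv.Perm (Fin d)) : latticeGraph d ≃g latticeGraph d where
  toFun v i := s i * v (π i)
  invFun v i := s (π.symm i) * v (π.symm i)
  left_inv v := by
    funext i
    simp only [Equiv.apply_symm_apply, ← mul_assoc, ← Units.val_mul, Int.units_mul_self,
      Units.val_one, one_mul]
  right_inv v := by
    funext i
    simp only [Equiv.symm_apply_apply, ← mul_assoc, ← Units.val_mul, Int.units_mul_self,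
      Units.val_one, one_mul]
  map_rel_iff' := by
    intro a b
    have h : ∀ i, |(s i : ℤ) * a (π i) - s i * b (π i)| = |a (π i) - b (π i)| := by
      intro i
      rw [← mul_sub, abs_mul]
      rcases Int.units_eq_one_or (s i) with h | h <;> simp [h]
    simp only [latticeGraph, Equiv.coe_fn_mk, h]
    rw [Equiv.sum_comp π fun i => |a i - b i|]

@[simp] theorem signedPerm_apply (s : Fin d → ℤˣ) (π : Equiv.Perm (Fin d)) (v : Fin d → ℤ)
    (i : Fin d) : signedPerm s π v i = s i * v (π i) := rfl

/-- The box `[-n, n]^d` as a finite set. -/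
def boxFinset (d n : ℕ) : Finset (Fin d → ℤ) :=
  Fintype.piFinset fun _ => Finset.Icc (-(n : ℤ)) n

theorem coe_boxFinset (n : ℕ) : (boxFinset d n : Set (Fin d → ℤ)) = box d n := by
  ext x; simp [boxFinset, box, abs_le, forall_and, Pi.le_def]

theorem mem_boxFinset {n : ℕ} {x : Fin d → ℤ} : x ∈ boxFinset d n ↔ ∀ i, |x i| ≤ n := by
  rw [← Finset.mem_coe, coe_boxFinset]; rfl

theorem card_boxFinset (n : ℕ) : (boxFinset d n).card = (2 * n + 1) ^ d := by
  rw [boxFinset, Fintype.card_piFinset_const, Int.card_Icc]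
  congr 1
  omega

theorem adj_abs_sub_le {x y : Fin d → ℤ} (h : (latticeGraph d).Adj x y) (i : Fin d) :
    |x i - y i| ≤ 1 := by
  have h1 : ∑ i, |x i - y i| = 1 := h
  rw [← h1]
  exact Finset.single_le_sum (f := fun i => |x i - y i|) (fun i _ => abs_nonneg _)
    (Finset.mem_univ i)

/-- An order interval of the lattice is connected. -/
theorem connectedIn_Icc {a b x y : Fin d → ℤ} (hx : x ∈ Set.Icc a b) (hy : y ∈ Set.Icc a b)
    {ω : Set (Fin d → ℤ)} (hω : Set.Icc a b ⊆ ω) : ConnectedIn (Set.Icc a b) x y ω := by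
  obtain ⟨n, hn⟩ : ∃ n, n = ∑ i, (y i - x i).natAbs := ⟨_, rfl⟩
  induction n generalizing y with
  | zero =>
    have : y = x := by
      funext i
      have := (Finset.sum_eq_zero_iff.1 hn.symm) i (Finset.mem_univ i)
      omega
    rw [this]
    exact .refl ⟨hω hx, hx⟩
  | succ n ih =>
    obtain ⟨i, -, hi⟩ : ∃ i ∈ Finset.univ, (y i - x i).natAbs ≠ 0 := by
      by_contra! hcon
      rw [Finset.sum_eq_zero hcon] at hn
      omega
    set c : ℤ := if x i < y i then y i - 1 else y i + 1 with hc
    set z := Function.update y i c with hz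
    have hzi : z i = c := Function.update_self ..
    have hzj : ∀ j, j ≠ i → z j = y j := fun j hj => Function.update_of_ne hj ..
    have hxy : x i ≠ y i := by omega
    have hzI : z ∈ Set.Icc a b := by
      constructor <;> intro j <;> by_cases hj : j = i
      · subst hj; rw [hzi]
        have h1 : a j ≤ x j := hx.1 j
        have h2 : a j ≤ y j := hy.1 j
        simp only [hc]; split_ifs <;> omega
      · rw [hzj j hj]; exact hy.1 j
      · subst hj; rw [hzi]
        have h1 : x j ≤ b j := hx.2 j
        have h2 : y j ≤ b j := hy.2 j
        simp only [hc]; split_ifs <;> omega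
      · rw [hzj j hj]; exact hy.2 j
    have hsum : n = ∑ i, (z i - x i).natAbs := by
      rw [← Finset.add_sum_erase _ _ (Finset.mem_univ i)] at hn ⊢
      rw [Finset.sum_congr rfl (g := fun j => (y j - x j).natAbs)
        (fun j hj => by rw [hzj j (Finset.ne_of_mem_erase hj)]), hzi]
      have : (c - x i).natAbs + 1 = (y i - x i).natAbs := by
        simp only [hc]; split_ifs <;> omega
      omega
    refine (ih hzI hsum).tail ?_ ⟨hω hy, hy⟩
    show ∑ j, |z j - y j| = 1
    rw [Finset.sum_eq_single i]
    · rw [hzi]; simp only [hc]; split_ifs <;> simp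
    · intro j _ hj
      rw [hzj j hj]; simp
    · simp

end Connectivity

/-! ### Cluster exploration and exponential decay. -/

section Exploration

variable {d : ℕ}

instance (p : unitInterval) : IsProbabilityMeasure (siteMeasure d p) := by
  unfold siteMeasure; infer_instance

/-- The site `y` is adjacent to the open cluster of the origin within `S`. -/
def exitEvent (S : Set (Fin d → ℤ)) (y : Fin d → ℤ) : Set (Set (Fin d → ℤ)) :=
  {ω | ∃ x ∈ S, (latticeGraph d).Adj x y ∧ ConnectedIn S 0 x ω}

/-- The site `v` is connected within `Γ` to some site of `Z`. -/
def reachEvent (Γ : Set (Fin d → ℤ)) (v : Fin d → ℤ) (Z : Set (Fin d → ℤ)) :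
    Set (Set (Fin d → ℤ)) :=
  {ω | ∃ z ∈ Z, ConnectedIn Γ v z ω}

theorem determinedBy_exitEvent (S : Set (Fin d → ℤ)) (y : Fin d → ℤ) :
    DeterminedBy S (exitEvent S y) := fun ω ω' h =>
  exists_congr fun x => and_congr_right fun _ => and_congr_right fun _ =>
    determinedBy_connectedIn S 0 x ω ω' h

theorem determinedBy_reachEvent (Γ : Set (Fin d → ℤ)) (v : Fin d → ℤ) (Z : Set (Fin d → ℤ)) :
    DeterminedBy Γ (reachEvent Γ v Z) := fun ω ω' h =>
  exists_congr fun x => and_congr_right fun _ => determinedBy_connectedIn Γ v x ω ω' h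

/-- A path from the origin to a site outside its cluster within `S` makes a last exit from that
cluster. -/
theorem exists_last_exit {S Γ ω : Set (Fin d → ℤ)} (h0 : (0 : Fin d → ℤ) ∈ S) {z : Fin d → ℤ}
    (h : ConnectedIn Γ 0 z ω) (hz : z ∉ S) :
    ∃ x y, ConnectedIn S 0 x ω ∧ (latticeGraph d).Adj x y ∧ y ∉ S ∧
      ConnectedIn (Γ \ {v | ConnectedIn S 0 v ω}) y z ω := by
  have key : ConnectedIn S 0 z ω ∨ ∃ x y, ConnectedIn S 0 x ω ∧ (latticeGraph d).Adj x y ∧ y ∉ S ∧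
      ConnectedIn (Γ \ {v | ConnectedIn S 0 v ω}) y z ω := by
    refine h.induction_on (P := fun z => ConnectedIn S 0 z ω ∨ ∃ x y, ConnectedIn S 0 x ω ∧
      (latticeGraph d).Adj x y ∧ y ∉ S ∧ ConnectedIn (Γ \ {v | ConnectedIn S 0 v ω}) y z ω)
      (Or.inl (.refl ⟨h.left_mem.1, h0⟩)) ?_
    rintro a b - hP hab hb
    by_cases hbS : ConnectedIn S 0 b ω
    · exact Or.inl hbS
    · rcases hP with ha | ⟨x, y, hx, hxy, hy, hya⟩
      · exact Or.inr ⟨a, b, ha, hab, fun hb' => hbS (ha.tail hab ⟨hb.1, hb'⟩),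
          .refl ⟨hb.1, hb.2, hbS⟩⟩
      · exact Or.inr ⟨x, y, hx, hxy, hy, hya.tail hab ⟨hb.1, hb.2, hbS⟩⟩
  exact key.resolve_left fun hc => hz hc.right_mem.2

open Classical in
/-- Exploring the cluster of the origin within `S`. -/
theorem measureReal_reachEvent_le (p : unitInterval) (S T Γ : Finset (Fin d → ℤ))
    (h0 : 0 ∈ S) (hT : ∀ x ∈ S, ∀ y, (latticeGraph d).Adj x y → y ∈ T)
    (Z : Set (Fin d → ℤ)) (hZ : ∀ z ∈ Z, z ∉ S) :
    (siteMeasure d p).real (reachEvent (Γ : Set (Fin d → ℤ)) 0 Z) ≤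
      ∑ y ∈ T \ S, (siteMeasure d p).real (exitEvent (S : Set (Fin d → ℤ)) y) *
        (siteMeasure d p).real (reachEvent (Γ : Set (Fin d → ℤ)) y Z) := by
  set μ := siteMeasure d p with hμ
  have : IsProbabilityMeasure μ := by rw [hμ]; infer_instance
  set A : Finset (Fin d → ℤ) → Set (Set (Fin d → ℤ)) := fun C =>
    {ω | {x | ConnectedIn (S : Set (Fin d → ℤ)) 0 x ω} = C} with hA
  -- `C` with its neighbours in `S`: these sites decide whether the cluster equals `C`. An open
  -- neighbour in `S` would belong to the cluster, so the path after the last exit avoids `D C` and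
  -- its event is independent of `A C`.
  set D : Finset (Fin d → ℤ) → Finset (Fin d → ℤ) := fun C =>
    S.filter fun x => x ∈ C ∨ ∃ c ∈ C, (latticeGraph d).Adj c x with hD
  have hAmem : ∀ C ω x, ω ∈ A C → (x ∈ C ↔ ConnectedIn (S : Set (Fin d → ℤ)) 0 x ω) := by
    intro C ω x h
    exact (Set.ext_iff.1 (show _ = (C : Set (Fin d → ℤ)) from h) x).symm
  have hAdet : ∀ C, 0 ∈ C → DeterminedBy (D C : Set (Fin d → ℤ)) (A C) := by
    have key : ∀ C, 0 ∈ C → ∀ ω ω' : Set (Fin d → ℤ),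
        ω ∩ (D C : Set (Fin d → ℤ)) = ω' ∩ (D C : Set (Fin d → ℤ)) → ω ∈ A C → ω' ∈ A C := by
      intro C hC ω ω' h hω
      have hiff : ∀ x ∈ D C, (x ∈ ω ↔ x ∈ ω') := by
        intro x hx
        have := Set.ext_iff.1 h x
        simpa [hx] using this
      have h1 : ∀ x, ConnectedIn (S : Set (Fin d → ℤ)) 0 x ω →
          ConnectedIn (S : Set (Fin d → ℤ)) 0 x ω' := by
        intro x hx
        have hmem : ∀ y, ConnectedIn (S : Set (Fin d → ℤ)) 0 y ω → y ∈ ω' ∩ S := by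
          intro y hy
          have hyS : y ∈ S := hy.right_mem.2
          exact ⟨(hiff y (Finset.mem_filter.2 ⟨hyS, Or.inl ((hAmem C ω y hω).2 hy)⟩)).1
            hy.right_mem.1, hyS⟩
        refine hx.induction_on (P := fun x => ConnectedIn (S : Set (Fin d → ℤ)) 0 x ω')
          (.refl (hmem 0 (.refl hx.left_mem))) ?_
        intro a b ha ha' hab hb
        exact ha'.tail hab (hmem b (ha.tail hab hb))
      refine Set.ext fun x => ⟨fun hx => ?_, fun hx => h1 x ((hAmem C ω x hω).1 hx)⟩
      refine (hAmem C ω x hω).2 (ConnectedIn.induction_on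
        (P := fun x => ConnectedIn (S : Set (Fin d → ℤ)) 0 x ω) hx ((hAmem C ω 0 hω).1 hC) ?_)
      intro a b _ ha hab hb
      have hbD : b ∈ D C := Finset.mem_filter.2 ⟨hb.2, Or.inr ⟨a, (hAmem C ω a hω).2 ha, hab⟩⟩
      exact ha.tail hab ⟨(hiff b hbD).2 hb.1, hb.2⟩
    exact fun C hC ω ω' h => ⟨key C hC ω ω' h, key C hC ω' ω h.symm⟩
  set P0 := S.powerset.filter (fun C => 0 ∈ C) with hP0
  set Y : Finset (Fin d → ℤ) → Finset (Fin d → ℤ) := fun C =>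
    (T \ S).filter fun y => ∃ c ∈ C, (latticeGraph d).Adj c y with hY
  have hsub : reachEvent (Γ : Set (Fin d → ℤ)) 0 Z ⊆
      ⋃ C ∈ P0, ⋃ y ∈ Y C, A C ∩
        reachEvent ((Γ \ D C : Finset (Fin d → ℤ)) : Set (Fin d → ℤ)) y Z := by
    rintro ω ⟨z, hz, hc⟩
    have h0ω : (0 : Fin d → ℤ) ∈ ω := hc.left_mem.1
    obtain ⟨x, y, hx, hxy, hy, hyz⟩ := exists_last_exit (S := (S : Set (Fin d → ℤ)))
      (by exact_mod_cast h0) hc (by exact_mod_cast hZ z hz)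
    set C := S.filter fun x => ConnectedIn (S : Set (Fin d → ℤ)) 0 x ω with hCdef
    have hCA : ω ∈ A C := by
      ext x
      simp only [hCdef, Set.mem_ofPred_eq, Finset.coe_filter]
      exact ⟨fun h => ⟨h.right_mem.2, h⟩, fun h => h.2⟩
    have hCmem : ∀ x, x ∈ C ↔ ConnectedIn (S : Set (Fin d → ℤ)) 0 x ω := fun x => hAmem C ω x hCA
    simp only [Set.mem_iUnion, exists_prop]
    refine ⟨C, Finset.mem_filter.2 ⟨Finset.mem_powerset.2 (Finset.filter_subset _ _),
      (hCmem 0).2 (.refl ⟨h0ω, h0⟩)⟩, y, Finset.mem_filter.2 ⟨Finset.mem_sdiff.2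
        ⟨hT x hx.right_mem.2 y hxy, hy⟩, x, (hCmem x).2 hx, hxy⟩, hCA, z, hz, hyz.mono ?_⟩
    rintro v ⟨hvω, hvΓ, hv⟩
    refine ⟨hvω, ?_⟩
    rw [Finset.mem_coe, Finset.mem_sdiff]
    refine ⟨hvΓ, fun hvD => hv ?_⟩
    obtain ⟨hvS, hvC | ⟨c, hcC, hcv⟩⟩ := Finset.mem_filter.1 hvD
    · exact (hCmem v).1 hvC
    · exact ((hCmem c).1 hcC).tail hcv ⟨hvω, hvS⟩
  have hterm : ∀ C ∈ P0, ∀ y,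
      μ.real (A C ∩ reachEvent ((Γ \ D C : Finset (Fin d → ℤ)) : Set (Fin d → ℤ)) y Z) ≤
        μ.real (A C) * μ.real (reachEvent (Γ : Set (Fin d → ℤ)) y Z) := by
    intro C hC y
    have h1 := measureReal_inter_of_disjoint p (D C) (Γ \ D C) Finset.disjoint_sdiff
      (hAdet C (Finset.mem_filter.1 hC).2) (determinedBy_reachEvent _ y Z)
    rw [hμ, siteMeasure, h1]
    refine mul_le_mul_of_nonneg_left (measureReal_mono ?_) measureReal_nonneg
    rintro ω ⟨z, hz, hc⟩
    exact ⟨z, hz, hc.mono (Set.inter_subset_inter_right _ (by simp))⟩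
  have hexit : ∀ y, ∑ C ∈ P0.filter (fun C => ∃ c ∈ C, (latticeGraph d).Adj c y), μ.real (A C) ≤
      μ.real (exitEvent (S : Set (Fin d → ℤ)) y) := by
    intro y
    -- The events `A C` are disjoint for different `C`, so their probabilities add up inside the
    -- exit event.
    rw [← measureReal_biUnion_finset]
    · refine measureReal_mono ?_
      intro ω hω
      simp only [Set.mem_iUnion, exists_prop] at hω
      obtain ⟨C, hC, hωC⟩ := hω
      obtain ⟨-, c, hcC, hcy⟩ := Finset.mem_filter.1 hC
      have := (hAmem C ω c hωC).1 hcC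
      exact ⟨c, this.right_mem.2, hcy, this⟩
    · intro C _ C' _ hne
      refine Set.disjoint_left.2 fun ω h1 h2 => hne ?_
      ext x
      rw [hAmem C ω x h1, hAmem C' ω x h2]
    · intro C hC
      exact (hAdet C (Finset.mem_filter.1 (Finset.mem_filter.1 hC).1).2).measurableSet
  calc μ.real (reachEvent (Γ : Set (Fin d → ℤ)) 0 Z)
      ≤ ∑ C ∈ P0, ∑ y ∈ Y C,
          μ.real (A C ∩ reachEvent ((Γ \ D C : Finset (Fin d → ℤ)) : Set (Fin d → ℤ)) y Z) := by
        refine (measureReal_mono hsub (measure_ne_top _ _)).trans ((measureReal_biUnion_finset_le _ _).trans ?_)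
        exact Finset.sum_le_sum fun C _ => measureReal_biUnion_finset_le _ _
    _ ≤ ∑ C ∈ P0, ∑ y ∈ Y C, μ.real (A C) * μ.real (reachEvent (Γ : Set (Fin d → ℤ)) y Z) :=
        Finset.sum_le_sum fun C hC => Finset.sum_le_sum fun y _ => hterm C hC y
    _ = ∑ y ∈ T \ S, (∑ C ∈ P0.filter (fun C => ∃ c ∈ C, (latticeGraph d).Adj c y), μ.real (A C)) *
          μ.real (reachEvent (Γ : Set (Fin d → ℤ)) y Z) := by
        simp only [hY, Finset.sum_filter, Finset.sum_mul]
        rw [Finset.sum_comm]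
        refine Finset.sum_congr rfl fun y _ => Finset.sum_congr rfl fun C _ => ?_
        split_ifs <;> simp
    _ ≤ _ := Finset.sum_le_sum fun y _ => mul_le_mul_of_nonneg_right (hexit y) measureReal_nonneg

/-- The sphere of radius `n` in the sup norm. -/
def sphere (d n : ℕ) : Set (Fin d → ℤ) := {x | x ∈ box d n ∧ ∃ i, |x i| = n}

/-- The path is stopped on the sphere: a step changes each coordinate by at most 1, so the sphere
cannot be jumped over. -/
theorem connectedIn_sphere {Γ ω : Set (Fin d → ℤ)} {y z : Fin d → ℤ} (h : ConnectedIn Γ y z ω)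
    {n : ℕ} (hz : ∃ i, (n : ℤ) ≤ |z i - y i|) :
    ω ∈ reachEvent (translate y '' box d n) y (translate y '' sphere d n) := by
  have hbox : ∀ x, x ∈ translate y '' box d n ↔ ∀ i, |x i - y i| ≤ n := by
    intro x
    constructor
    · rintro ⟨v, hv, rfl⟩ i
      simpa using hv i
    · intro hx
      exact ⟨x - y, hx, by simp⟩
  have hsph : ∀ x, x ∈ translate y '' box d n → (∃ i, |x i - y i| = n) →
      x ∈ translate y '' sphere d n := by
    intro x hx hi
    exact ⟨x - y, ⟨(hbox x).1 hx, hi⟩, by simp⟩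
  have key : ConnectedIn (translate y '' box d n) y z ω ∨
      ω ∈ reachEvent (translate y '' box d n) y (translate y '' sphere d n) := by
    refine h.induction_on (P := fun z => ConnectedIn (translate y '' box d n) y z ω ∨
      ω ∈ reachEvent (translate y '' box d n) y (translate y '' sphere d n)) ?_ ?_
    · exact Or.inl (.refl ⟨h.left_mem.1, (hbox y).2 (by simp)⟩)
    · rintro a b - (ha | ha) hab hb
      · by_cases hs : ∃ i, |a i - y i| = n
        · exact Or.inr ⟨a, hsph a ha.right_mem.2 hs, ha⟩
        · refine Or.inl (ha.tail hab ⟨hb.1, (hbox b).2 fun i => ?_⟩)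
          have h1 := adj_abs_sub_le hab i
          have h2 := lt_of_le_of_ne ((hbox a).1 ha.right_mem.2 i) fun h => hs ⟨i, h⟩
          have h3 : |b i - y i| ≤ |a i - b i| + |a i - y i| := by
            rw [abs_sub_comm (a i) (b i)]; exact abs_sub_le _ _ _
          omega
      · exact Or.inr ha
  rcases key with hc | hc
  · obtain ⟨i, hi⟩ := hz
    exact ⟨z, hsph z hc.right_mem.2 ⟨i, le_antisymm ((hbox z).1 hc.right_mem.2 i) hi⟩, hc⟩
  · exact hc

theorem measureReal_reachEvent_translate (p : unitInterval) (n : ℕ) (y : Fin d → ℤ) :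
    (siteMeasure d p).real (reachEvent (translate y '' box d n) y (translate y '' sphere d n)) =
      (siteMeasure d p).real (reachEvent (box d n) 0 (sphere d n)) := by
  have hdet := determinedBy_reachEvent (box d n) 0 (sphere d n)
  rw [← coe_boxFinset] at hdet
  rw [siteMeasure, ← coe_boxFinset, ← measureReal_preimage_image p _ (translate y).toEquiv hdet]
  congr 1
  ext ω
  simp only [reachEvent, Set.mem_ofPred_eq, Set.exists_mem_image]
  refine exists_congr fun z => and_congr_right fun _ => ?_
  have := connectedIn_preimage (Γ := (boxFinset d n : Set (Fin d → ℤ))) (ω := ω) (x := 0) (y := z)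
    (translate y)
  rw [translate_apply, add_zero] at this
  exact this.symm

/-- If the expected number of exits from some finite set is less than one, then there is no
percolation. -/
theorem theta_eq_zero_of_sum_exitEvent_lt (p : unitInterval) (S : Finset (Fin d → ℤ)) (n : ℕ)
    (h0 : 0 ∈ S) (hS : (S : Set (Fin d → ℤ)) ⊆ box d n)
    (hφ : ∑ y ∈ boxFinset d (n + 1) \ S,
      (siteMeasure d p).real (exitEvent (S : Set (Fin d → ℤ)) y) < 1) :
    theta d p = 0 := by
  set φ := ∑ y ∈ boxFinset d (n + 1) \ S,
      (siteMeasure d p).real (exitEvent (S : Set (Fin d → ℤ)) y) with hφdef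
  have hφ0 : 0 ≤ φ := Finset.sum_nonneg fun _ _ => measureReal_nonneg
  set Q : ℕ → ℝ := fun k =>
    (siteMeasure d p).real (reachEvent (box d (k * (n + 1))) 0 (sphere d (k * (n + 1)))) with hQ
  -- An exit site has norm at most `n + 1`, so from there a distance of `k * (n + 1)` still has to
  -- be covered.
  have hstep : ∀ k, Q (k + 1) ≤ φ * Q k := by
    intro k
    have h1 := measureReal_reachEvent_le p S (boxFinset d (n + 1)) (boxFinset d ((k + 1) * (n + 1)))
      h0 (fun x hx y hxy => mem_boxFinset.2 fun i => by
        have h2 := adj_abs_sub_le hxy i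
        have h3 : |x i| ≤ n := hS hx i
        have h4 := abs_sub_abs_le_abs_sub (y i) (x i)
        rw [abs_sub_comm] at h4
        push_cast; linarith)
      (sphere d ((k + 1) * (n + 1))) (by
        rintro z ⟨_, i, hi⟩ hzS
        have h3 : |z i| ≤ n := hS hzS i
        rw [hi] at h3
        have : (k + 1) * (n + 1) ≤ n := by exact_mod_cast h3
        nlinarith)
    rw [coe_boxFinset] at h1
    refine h1.trans ?_
    rw [hφdef, Finset.sum_mul]
    refine Finset.sum_le_sum fun y hy => mul_le_mul_of_nonneg_left ?_ measureReal_nonneg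
    rw [hQ]
    dsimp only
    rw [← measureReal_reachEvent_translate p _ y]
    refine measureReal_mono ?_
    rintro ω ⟨z, ⟨-, i, hi⟩, hc⟩
    refine connectedIn_sphere hc ⟨i, ?_⟩
    have h2 := mem_boxFinset.1 (Finset.mem_sdiff.1 hy).1 i
    have h3 := abs_sub_abs_le_abs_sub (z i) (y i)
    rw [hi] at h3
    push_cast at h2 h3 ⊢
    linarith
  have hpow : ∀ k, Q k ≤ φ ^ k := by
    intro k
    induction k with
    | zero => simpa using measureReal_le_one
    | succ k ih =>
      rw [pow_succ']
      exact (hstep k).trans (mul_le_mul_of_nonneg_left ih hφ0)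
  have hθ : ∀ k, theta d p ≤ φ ^ k := by
    intro k
    refine le_trans (measureReal_mono ?_) (hpow k)
    intro ω hω
    have hω' : (cluster 0 ω).Infinite := hω
    obtain ⟨z, hz, hzb⟩ := hω'.exists_notMem_finset (boxFinset d (k * (n + 1)))
    rw [mem_boxFinset] at hzb
    push Not at hzb
    obtain ⟨i, hi⟩ := hzb
    have := connectedIn_sphere (show ConnectedIn Set.univ 0 z ω from hz) (n := k * (n + 1))
      ⟨i, by simpa using hi.le⟩
    have h2 : ⇑(translate (0 : Fin d → ℤ)) = id := by ext; simp
    simpa [h2] using this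
  refine le_antisymm ?_ measureReal_nonneg
  exact ge_of_tendsto' (tendsto_pow_atTop_nhds_zero_of_lt_one hφ0 hφ) hθ

end Exploration

/-! ### Well-connected sites at criticality. -/

section Critical

variable {d : ℕ}

/-- At criticality the expected number of exits from any finite set is at least one. -/
theorem one_le_sum_exitEvent_criticalProb (hd : 0 < d) (S : Finset (Fin d → ℤ)) (n : ℕ)
    (h0 : 0 ∈ S) (hS : (S : Set (Fin d → ℤ)) ⊆ box d n) :
    1 ≤ ∑ y ∈ boxFinset d (n + 1) \ S,
      (siteMeasure d (criticalProb d)).real (exitEvent (S : Set (Fin d → ℤ)) y) := by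
  classical
  by_contra! hlt
  have hcont : Continuous fun p : unitInterval => ∑ y ∈ boxFinset d (n + 1) \ S,
      (siteMeasure d p).real (exitEvent (S : Set (Fin d → ℤ)) y) :=
    continuous_finsetSum _ fun y _ => continuous_measureReal S (determinedBy_exitEvent _ y)
  -- If the critical density is 1 there is no larger density to compare with, but then all sites are
  -- almost surely open and some exit is certain.
  rcases eq_or_lt_of_le (le_top : criticalProb d ≤ ⊤) with htop | htop
  · rw [htop] at hlt
    have h1 : (⊤ : unitInterval) = 1 := rfl
    rw [h1] at hlt
    have hz : (fun _ => (n : ℤ) + 1 : Fin d → ℤ) ∉ (S : Set (Fin d → ℤ)) := by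
      intro hz
      have := hS hz ⟨0, hd⟩
      rw [abs_of_nonneg (by positivity)] at this
      linarith
    have hc : ConnectedIn (Set.Icc (0 : Fin d → ℤ) (fun _ => (n : ℤ) + 1)) 0 (fun _ => (n : ℤ) + 1)
        Set.univ := connectedIn_Icc ⟨le_rfl, fun i => by simp; positivity⟩
          ⟨fun i => by simp; positivity, le_rfl⟩ (Set.subset_univ _)
    obtain ⟨x, y, hx, hxy, hy, -⟩ := exists_last_exit (by exact_mod_cast h0) hc hz
    have hyT : y ∈ boxFinset d (n + 1) \ S := by
      refine Finset.mem_sdiff.2 ⟨mem_boxFinset.2 fun i => ?_, by exact_mod_cast hy⟩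
      have h2 := adj_abs_sub_le hxy i
      have h3 : |x i| ≤ n := hS hx.right_mem.2 i
      have h4 := abs_sub_abs_le_abs_sub (y i) (x i)
      rw [abs_sub_comm] at h4
      push_cast; linarith
    have hone : (siteMeasure d 1).real (exitEvent (S : Set (Fin d → ℤ)) y) = 1 := by
      rw [siteMeasure, setBernoulli_one, measureReal_def, Measure.dirac_apply_of_mem]
      · rfl
      · exact ⟨x, hx.right_mem.2, hxy, hx⟩
    have := Finset.single_le_sum (f := fun y => (siteMeasure d 1).real
      (exitEvent (S : Set (Fin d → ℤ)) y)) (fun _ _ => measureReal_nonneg) hyT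
    rw [hone] at this
    linarith
  · have hev := (hcont.tendsto (criticalProb d)).eventually (gt_mem_nhds hlt)
    obtain ⟨q, hq, hqS⟩ := exists_Ico_subset_of_mem_nhds hev ⟨⊤, htop⟩
    obtain ⟨p, hp1, hp2⟩ := exists_between hq
    have hφ := hqS ⟨hp1.le, hp2⟩
    have hθ := theta_eq_zero_of_sum_exitEvent_lt p S n h0 hS hφ
    exact absurd (le_sSup (show p ∈ {p | theta d p = 0} from hθ)) (not_le.2 hp1)

/-- For `S = {0}` an exit requires the origin to be open, which at density 0 would make the expected
number of exits vanish. -/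
theorem criticalProb_pos (hd : 0 < d) : (0 : ℝ) < criticalProb d := by
  classical
  refine lt_of_le_of_ne (criticalProb d).2.1 fun h => ?_
  have h1 := one_le_sum_exitEvent_criticalProb hd {0} 0 (by simp) (by
    intro x hx i
    have : x = 0 := by simpa using hx
    simp [this])
  refine absurd h1 (not_le.2 (lt_of_le_of_lt (Finset.sum_nonpos fun y _ => ?_) zero_lt_one))
  have h2 := measureReal_subset (criticalProb d) ({0} : Finset (Fin d → ℤ))
  rw [← h] at h2
  rw [siteMeasure]
  refine (measureReal_mono ?_).trans h2.le |>.trans (by simp)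
  rintro ω ⟨x, _, _, hc⟩
  simpa using hc.left_mem.1

/-- The probability that the origin is connected to `y` within `[-N, N]^d`. -/
def boxConn (d N : ℕ) (y : Fin d → ℤ) : ℝ :=
  (siteMeasure d (criticalProb d)).real {ω | ConnectedIn (box d N) 0 y ω}

theorem criticalProb_le_boxConn_zero (N : ℕ) : (criticalProb d : ℝ) ≤ boxConn d N 0 := by
  have h2 := measureReal_subset (criticalProb d) ({0} : Finset (Fin d → ℤ))
  rw [Finset.card_singleton, pow_one] at h2
  rw [boxConn, siteMeasure, ← h2]
  refine measureReal_mono ?_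
  intro ω hω
  exact .refl ⟨by simpa using hω, by simp [box]⟩

open Classical in
/-- From any finite set one can exit at a site which is not too unlikely to be connected to the
origin. -/
theorem exists_exit_boxConn_ge (hd : 0 < d) (N : ℕ) (S : Finset (Fin d → ℤ)) (h0 : 0 ∈ S)
    (hS : (S : Set (Fin d → ℤ)) ⊆ box d N) :
    ∃ x ∈ S, ∃ y ∈ boxFinset d (N + 1) \ S, (latticeGraph d).Adj x y ∧
      (criticalProb d : ℝ) / (2 * (N + 1 : ℕ) + 1) ^ d ≤ boxConn d (N + 1) y := by
  set p := criticalProb d with hp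
  set K : ℝ := (2 * (N + 1 : ℕ) + 1) ^ d with hK
  have hK0 : 0 < K := by positivity
  have h1 := one_le_sum_exitEvent_criticalProb hd S N h0 hS
  obtain ⟨y, hy, hyle⟩ : ∃ y ∈ boxFinset d (N + 1) \ S,
      1 / K ≤ (siteMeasure d p).real (exitEvent (S : Set (Fin d → ℤ)) y) := by
    by_contra! hcon
    have hne : (boxFinset d (N + 1) \ S).Nonempty := by
      rw [Finset.nonempty_iff_ne_empty]
      intro h
      rw [h] at h1
      norm_num at h1
    have h2 := Finset.sum_lt_sum_of_nonempty hne hcon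
    rw [Finset.sum_const, nsmul_eq_mul] at h2
    have h3 : ((boxFinset d (N + 1) \ S).card : ℝ) ≤ K := by
      have := Finset.card_le_card (Finset.sdiff_subset (s := boxFinset d (N + 1)) (t := S))
      rw [card_boxFinset] at this
      rw [hK]
      exact_mod_cast this
    have h4 : ((boxFinset d (N + 1) \ S).card : ℝ) * (1 / K) ≤ 1 := by
      rw [mul_one_div, div_le_one hK0]; exact h3
    linarith
  have hyS := Finset.mem_sdiff.1 hy
  have hpos : 0 < (siteMeasure d p).real (exitEvent (S : Set (Fin d → ℤ)) y) :=
    lt_of_lt_of_le (by positivity) hyle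
  obtain ⟨ω, x, hx, hxy, -⟩ : (exitEvent (S : Set (Fin d → ℤ)) y).Nonempty := by
    rw [Set.nonempty_iff_ne_empty]
    intro h
    rw [h] at hpos
    simp at hpos
  refine ⟨x, hx, y, hy, hxy, ?_⟩
  have hy1 := measureReal_subset p ({y} : Finset (Fin d → ℤ))
  rw [Finset.card_singleton, pow_one] at hy1
  -- The exit event does not look at `y`; opening `y` costs an independent factor `p`.
  have hind := measureReal_inter_of_disjoint p S {y} (by simpa using hyS.2)
    (determinedBy_exitEvent _ y) (E' := {ω | (({y} : Finset (Fin d → ℤ)) : Set (Fin d → ℤ)) ⊆ ω}) (by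
      intro ω ω' h
      have := Set.ext_iff.1 h y
      simpa using this)
  rw [hy1] at hind
  calc (p : ℝ) / K = 1 / K * p := by ring
    _ ≤ _ := mul_le_mul_of_nonneg_right hyle p.2.1
    _ = _ := hind.symm
    _ ≤ boxConn d (N + 1) y := by
      refine measureReal_mono ?_ (measure_ne_top (siteMeasure d p) _)
      rintro ω ⟨⟨x', hx', hxy', hc⟩, hyω⟩
      have hbox : (S : Set (Fin d → ℤ)) ⊆ box d (N + 1) := fun v hv i => by
        have := hS hv i; push_cast; linarith
      refine (hc.mono (Set.inter_subset_inter_right _ hbox)).tail hxy' ⟨by simpa using hyω, ?_⟩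
      rw [← coe_boxFinset]
      exact hyS.1

/-- The sites which are not too unlikely to be connected to the origin within `[-N, N]^d` contain a
path from the origin to the boundary of this box. -/
theorem exists_path_boxConn_ge (hd : 0 < d) (N : ℕ) (hN : 0 < N) :
    ∃ (g : ℕ → Fin d → ℤ) (L : ℕ), g 0 = 0 ∧ (∀ t i, |g (t + 1) i - g t i| ≤ 1) ∧
      (∀ t, (criticalProb d : ℝ) / (2 * N + 1) ^ d ≤ boxConn d N (g t)) ∧
      ∀ t, L ≤ t → (∀ i, |g t i| ≤ N) ∧ ∃ i, |g t i| = N := by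
  classical
  obtain ⟨M, rfl⟩ : ∃ M, N = M + 1 := ⟨N - 1, by omega⟩
  set δ : ℝ := (criticalProb d : ℝ) / (2 * (M + 1 : ℕ) + 1) ^ d with hδ
  set r : (Fin d → ℤ) → (Fin d → ℤ) → Prop := fun a b => (latticeGraph d).Adj a b ∧
    δ ≤ boxConn d (M + 1) b ∧ b ∈ boxFinset d (M + 1) with hr
  have hseq : ∀ y, Relation.ReflTransGen r 0 y → ∃ (g : ℕ → Fin d → ℤ) (L : ℕ), g 0 = 0 ∧
      (∀ t i, |g (t + 1) i - g t i| ≤ 1) ∧ (∀ t, δ ≤ boxConn d (M + 1) (g t)) ∧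
      ∀ t, L ≤ t → g t = y := by
    intro y hy
    induction hy with
    | refl =>
      refine ⟨fun _ => 0, 0, rfl, by simp, fun _ => ?_, fun _ _ => rfl⟩
      refine le_trans ?_ (criticalProb_le_boxConn_zero _)
      refine div_le_self (criticalProb d).2.1 (one_le_pow₀ ?_)
      have : (0 : ℝ) ≤ (M + 1 : ℕ) := Nat.cast_nonneg _
      linarith
    | tail _ hab ih =>
      rename_i a b _
      obtain ⟨g, L, hg0, hg1, hg2, hg3⟩ := ih
      refine ⟨fun t => if t ≤ L then g t else b, L + 1, by simp [hg0], fun t i => ?_, fun t => ?_,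
        fun t ht => if_neg (by omega)⟩
      · rcases lt_trichotomy t L with h | h | h
        · simp only [show t + 1 ≤ L by omega, h.le, if_true]
          exact hg1 t i
        · subst h
          simp only [le_refl, if_true, show ¬ t + 1 ≤ t by omega, if_false]
          rw [hg3 t le_rfl, abs_sub_comm]
          exact adj_abs_sub_le hab.1 i
        · simp [show ¬ t + 1 ≤ L by omega, show ¬ t ≤ L by omega]
      · dsimp only
        split_ifs
        exacts [hg2 t, hab.2.1]
  suffices h : ∃ y, Relation.ReflTransGen r 0 y ∧ y ∈ boxFinset d (M + 1) ∧
      ∃ i, |y i| = (M + 1 : ℕ) by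
    obtain ⟨y, hy, hyb, hyi⟩ := h
    obtain ⟨g, L, hg0, hg1, hg2, hg3⟩ := hseq y hy
    exact ⟨g, L, hg0, hg1, hg2, fun t ht => by rw [hg3 t ht]; exact ⟨mem_boxFinset.1 hyb, hyi⟩⟩
  by_contra! hcon
  -- If no good path reached the sphere, this set would fit in the smaller box and have a good exit
  -- site, which then belongs to it.
  set S := (boxFinset d (M + 1)).filter fun y => Relation.ReflTransGen r 0 y with hSdef
  have h0 : 0 ∈ S := Finset.mem_filter.2 ⟨mem_boxFinset.2 fun i => by
    rw [Pi.zero_apply, abs_zero]; exact Int.natCast_nonneg _, .refl⟩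
  have hS : (S : Set (Fin d → ℤ)) ⊆ box d M := by
    intro y hy i
    obtain ⟨hyb, hy0⟩ := Finset.mem_filter.1 hy
    have h1 := mem_boxFinset.1 hyb i
    have h2 := hcon y hy0 hyb i
    have := lt_of_le_of_ne h1 h2
    push_cast at this
    omega
  obtain ⟨x, hx, y, hy, hxy, hyδ⟩ := exists_exit_boxConn_ge hd M S h0 hS
  obtain ⟨hyb, hyS⟩ := Finset.mem_sdiff.1 hy
  exact hyS (Finset.mem_filter.2 ⟨hyb, (Finset.mem_filter.1 hx).2.tail ⟨hxy, hyδ, hyb⟩⟩)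

/-- The decreasing rearrangement is a contraction for the sup norm. -/
theorem sort_abs_le_add_one {v v' : Fin d → ℤ} (h : ∀ i, |v i - v' i| ≤ 1) (i : Fin d) :
    |v' (Tuple.sort (fun i => -|v' i|) i)| ≤ |v (Tuple.sort (fun i => -|v i|) i)| + 1 := by
  set σ := Tuple.sort (fun i => -|v i|) with hσ
  set σ' := Tuple.sort (fun i => -|v' i|) with hσ'
  have hm := Tuple.monotone_sort (fun i => -|v i|)
  have hm' := Tuple.monotone_sort (fun i => -|v' i|)
  -- Pigeonhole: the positions of the top `i + 1` entries of `v'` cannot all have rank below `i` in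
  -- `v`.
  obtain ⟨k, hk, hik⟩ : ∃ k ≤ i, i ≤ σ.symm (σ' k) := by
    by_contra! hcon
    have := Finset.card_le_card_of_injOn (s := Finset.Iic i) (t := Finset.Iio i)
      (fun k => σ.symm (σ' k)) (fun k hk => by simpa using hcon k (by simpa using hk))
      (fun a _ b _ hab => σ'.injective (σ.symm.injective hab))
    rw [Fin.card_Iic, Fin.card_Iio] at this
    omega
  have h1 := hm' hk
  have h2 := hm hik
  simp only [Function.comp_apply] at h1 h2
  rw [← hσ'] at h1
  rw [← hσ, Equiv.apply_symm_apply] at h2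
  have h3 := abs_sub_abs_le_abs_sub (v' (σ' k)) (v (σ' k))
  rw [abs_sub_comm] at h3
  have h4 := h (σ' k)
  linarith

/-- Connection probabilities from the origin are invariant under signed permutations. -/
theorem boxConn_eq_of_abs_eq (N : ℕ) {w v : Fin d → ℤ} (π : Equiv.Perm (Fin d))
    (h : ∀ i, |w i| = |v (π i)|) : boxConn d N w = boxConn d N v := by
  set s : Fin d → ℤˣ := fun i => if w i = v (π i) then 1 else -1 with hs
  have hw : signedPerm s π v = w := by
    funext i
    rw [signedPerm_apply]
    simp only [hs]
    split_ifs with hi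
    · simp [hi]
    · have := (abs_eq_abs.1 (h i)).resolve_left hi
      simp [this]
  have h0 : signedPerm s π 0 = 0 := by funext i; simp
  have hbox : signedPerm s π '' box d N = box d N := by
    have habs : ∀ (s : Fin d → ℤˣ) (i : Fin d) (a : ℤ), |(s i : ℤ) * a| = |a| := by
      intro s i a
      rcases Int.units_eq_one_or (s i) with h | h <;> simp [h]
    ext x
    constructor
    · rintro ⟨y, hy, rfl⟩ i
      rw [signedPerm_apply, habs]
      exact hy (π i)
    · intro hx
      refine ⟨(signedPerm s π).symm x, fun i => ?_, by simp⟩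
      have : (signedPerm s π).symm x i = s (π.symm i) * x (π.symm i) := rfl
      rw [this, habs]
      exact hx _
  have := measureReal_connectedIn_image (criticalProb d) (boxFinset d N) (signedPerm s π) 0 v
  rw [coe_boxFinset, h0, hw, hbox] at this
  exact this

/-- A curve in the chamber `v₁ ≥ … ≥ v_d ≥ 0` of sites which, with all their images under signed
permutations, are not too unlikely to be connected to the origin. -/
theorem exists_chamber_path (hd : 0 < d) (N : ℕ) (hN : 0 < N) :
    ∃ γ : ℕ → Fin d → ℤ, γ 0 = 0 ∧ (∀ t i, |γ (t + 1) i - γ t i| ≤ 1) ∧ (∀ t i, 0 ≤ γ t i) ∧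
      (∀ t, Antitone (γ t)) ∧ (∃ L, ∀ t, L ≤ t → γ t ⟨0, hd⟩ = N) ∧
      ∀ t (w : Fin d → ℤ) (ρ : Equiv.Perm (Fin d)), (∀ i, |w i| = |γ t (ρ i)|) →
        (criticalProb d : ℝ) / (2 * N + 1) ^ d ≤ boxConn d N w := by
  obtain ⟨g, L, hg0, hg1, hg2, hg3⟩ := exists_path_boxConn_ge hd N hN
  have hanti : ∀ t, Antitone fun i => |g t (Tuple.sort (fun i => -|g t i|) i)| := by
    intro t i j hij
    have := Tuple.monotone_sort (fun i => -|g t i|) hij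
    simp only [Function.comp_apply] at this
    dsimp only
    linarith
  refine ⟨fun t i => |g t (Tuple.sort (fun i => -|g t i|) i)|, ?_, fun t i => ?_,
    fun t i => abs_nonneg _, hanti, ⟨L, fun t ht => ?_⟩, fun t w ρ hw => ?_⟩
  · funext i; simp [hg0]
  · have h1 := sort_abs_le_add_one (v := g t) (v' := g (t + 1))
      (fun i => by rw [abs_sub_comm]; exact hg1 t i) i
    have h2 := sort_abs_le_add_one (v := g (t + 1)) (v' := g t) (hg1 t) i
    rw [abs_le]
    constructor <;> linarith
  · obtain ⟨hle, i, hi⟩ := hg3 t ht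
    refine le_antisymm (hle _) ?_
    have := hanti t (show (⟨0, hd⟩ : Fin d) ≤ (Tuple.sort (fun i => -|g t i|)).symm i from
      Fin.mk_le_of_le_val (Nat.zero_le _))
    simp only [Equiv.apply_symm_apply, hi] at this
    exact this
  · rw [boxConn_eq_of_abs_eq N (ρ.trans (Tuple.sort fun i => -|g t i|)) (v := g t)
      (fun i => by rw [hw i, abs_abs]; rfl)]
    exact hg2 t

end Critical

/-! ### Chaining connections between two points. -/

section PointToPoint

variable {d : ℕ}

/-- Translation invariance, and monotonicity in the region. -/
theorem boxConn_le (N m : ℕ) (a w : Fin d → ℤ) (h : ∀ i, |a i| + N ≤ m) :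
    boxConn d N w ≤
      (siteMeasure d (criticalProb d)).real {ω | ConnectedIn (box d m) a (a + w) ω} := by
  have h1 := measureReal_connectedIn_image (criticalProb d) (boxFinset d N) (translate a) 0 w
  rw [coe_boxFinset, translate_apply, translate_apply, add_zero] at h1
  rw [boxConn, ← h1]
  refine measureReal_mono fun ω hω => ConnectedIn.mono hω (Set.inter_subset_inter_right _ ?_)
  rintro _ ⟨v, hv, rfl⟩ i
  have h2 : |v i| ≤ N := hv i
  have h3 := abs_add_le (a i) (v i)
  show |a i + v i| ≤ m
  linarith [h i]

/-- Concatenation of connections, by the Harris inequality. -/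
theorem measureReal_connectedIn_mul_le (p : unitInterval) (m : ℕ) (x y z : Fin d → ℤ) :
    (siteMeasure d p).real {ω | ConnectedIn (box d m) x y ω} *
      (siteMeasure d p).real {ω | ConnectedIn (box d m) y z ω} ≤
        (siteMeasure d p).real {ω | ConnectedIn (box d m) x z ω} := by
  have hdet : ∀ x y, DeterminedBy (boxFinset d m : Set (Fin d → ℤ))
      {ω | ConnectedIn (box d m) x y ω} := by
    intro x y
    rw [coe_boxFinset]
    exact determinedBy_connectedIn _ x y
  refine (measureReal_mul_le_inter p (boxFinset d m) (hdet x y) (hdet y z)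
    (isUpperSet_connectedIn _ x y) (isUpperSet_connectedIn _ y z)).trans ?_
  exact measureReal_mono (fun ω hω => ConnectedIn.trans hω.1 hω.2)
    (measure_ne_top (siteMeasure d p) _)

/-- Two points of a cube of radius `C` are connected if all the sites of the cube are open. -/
theorem pow_le_measureReal_connectedIn (p : unitInterval) (C m : ℕ) (c x y : Fin d → ℤ)
    (hx : ∀ i, |x i - c i| ≤ C) (hy : ∀ i, |y i - c i| ≤ C) (hc : ∀ i, |c i| + C ≤ m) :
    (p : ℝ) ^ (2 * C + 1) ^ d ≤ (siteMeasure d p).real {ω | ConnectedIn (box d m) x y ω} := by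
  set F : Finset (Fin d → ℤ) := Fintype.piFinset fun i => Finset.Icc (c i - C) (c i + C) with hF
  have hcard : F.card = (2 * C + 1) ^ d := by
    rw [hF, Fintype.card_piFinset]
    have : ∀ i, (Finset.Icc (c i - C) (c i + C)).card = 2 * C + 1 := by
      intro i; rw [Int.card_Icc]; omega
    simp [this]
  have hFI : (F : Set (Fin d → ℤ)) = Set.Icc (fun i => c i - C) (fun i => c i + C) := by
    ext v; simp [hF, Pi.le_def]
  rw [← hcard, ← measureReal_subset p F, siteMeasure]
  refine measureReal_mono ?_
  intro ω hω
  have hI : Set.Icc (fun i => c i - (C : ℤ)) (fun i => c i + (C : ℤ)) ⊆ ω := by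
    rw [← hFI]; exact hω
  have hmem : ∀ v : Fin d → ℤ, (∀ i, |v i - c i| ≤ C) →
      v ∈ Set.Icc (fun i => c i - (C : ℤ)) (fun i => c i + (C : ℤ)) := by
    intro v hv
    constructor <;> intro i <;> have := abs_le.1 (hv i) <;> dsimp only <;> linarith
  refine (connectedIn_Icc (hmem x hx) (hmem y hy) hI).mono (Set.inter_subset_inter_right _ ?_)
  intro v hv i
  have h1 : c i - C ≤ v i := hv.1 i
  have h2 : v i ≤ c i + C := hv.2 i
  have h3 := abs_le.1 (le_refl |c i|)
  have h4 := hc i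
  rw [abs_le]
  constructor <;> linarith

/-- Steps are added one at a time by Harris' inequality. Each starts at a partial sum of norm at
most `M` and uses a box of radius `N` around it; the factor `criticalProb d` pays for the empty
chain, where `x` alone must be open. -/
theorem pow_mul_pow_le_measureReal_connectedIn (U : Finset (Fin d → ℤ))
    (w : (Fin d → ℤ) → Fin d → ℤ) (x : Fin d → ℤ) (N M m : ℕ) (δ : ℝ) (hδ0 : 0 ≤ δ)
    (hδ : ∀ u, δ ≤ boxConn d N (w u)) (hx : ∀ U' ⊆ U, ∀ i, |x i + ∑ u ∈ U', w u i| ≤ M)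
    (hm : M + N ≤ m) :
    (criticalProb d : ℝ) * δ ^ U.card ≤ (siteMeasure d (criticalProb d)).real
      {ω | ConnectedIn (box d m) x (x + ∑ u ∈ U, w u) ω} := by
  classical
  induction U using Finset.induction_on with
  | empty =>
    have h2 := boxConn_le N m x 0 (fun i => by
      have := hx ∅ (Finset.empty_subset _) i
      simp only [Finset.sum_empty, add_zero] at this
      have hm' : (M : ℤ) + N ≤ m := by exact_mod_cast hm
      linarith)
    simpa using (criticalProb_le_boxConn_zero N).trans h2
  | insert u U hu ih =>
    have ih := ih fun U' hU' => hx U' (hU'.trans (Finset.subset_insert _ _))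
    have h2 := boxConn_le N m (x + ∑ u ∈ U, w u) (w u) (fun i => by
      have := hx U (Finset.subset_insert _ _) i
      have hm' : (M : ℤ) + N ≤ m := by exact_mod_cast hm
      rw [Pi.add_apply, Finset.sum_apply]
      linarith)
    have h3 := measureReal_connectedIn_mul_le (criticalProb d) m x (x + ∑ u ∈ U, w u)
      (x + ∑ u ∈ U, w u + w u)
    rw [Finset.card_insert_of_notMem hu, pow_succ, ← mul_assoc, Finset.sum_insert hu,
      add_comm (w u), ← add_assoc]
    exact (mul_le_mul ih ((hδ u).trans h2) hδ0 measureReal_nonneg).trans h3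

/-- A lower bound for point-to-point connection probabilities in critical percolation. -/
theorem le_measureReal_connectedIn_criticalProb (d : ℕ) (hd : 2 ≤ d) :
    ∃ c' : ℝ, 0 < c' ∧
      ∀ n : ℕ, 1 ≤ n →
        ∀ x ∈ box d n, ∀ y ∈ box d n,
          c' / (n : ℝ) ^ (d ^ 2) ≤
            (siteMeasure d (criticalProb d)).real
              {ω | ConnectedIn (box d (9 * n)) x y ω} := by
  have hd0 : 0 < d := by omega
  obtain ⟨C, hC⟩ := exists_sum_signed_perms hd0
  set p : ℝ := (criticalProb d).1 with hp
  have hp0 : 0 < p := criticalProb_pos hd0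
  have hp1 : p ≤ 1 := (criticalProb d).2.2
  set A : ℝ := p ^ (2 * C + 1) ^ d with hA
  have hA0 : 0 < A := by positivity
  refine ⟨A * (p * (p ^ d / 7 ^ d ^ 2)), by positivity, fun n hn x hx y hy => ?_⟩
  have hn' : (1 : ℝ) ≤ n := by exact_mod_cast hn
  have hnpow : (1 : ℝ) ≤ (n : ℝ) ^ d ^ 2 := one_le_pow₀ hn'
  -- For `n ≤ C` the topological lemma has no room; opening all of `[-n, n]^d` costs at most the
  -- constant `A`.
  rcases le_or_gt n C with hnC | hnC
  · have h1 := pow_le_measureReal_connectedIn (criticalProb d) n (9 * n) 0 x y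
      (fun i => by simpa using hx i) (fun i => by simpa using hy i) (by intro i; simp; omega)
    refine le_trans ?_ h1
    have h2 : A ≤ p ^ (2 * n + 1) ^ d :=
      pow_le_pow_of_le_one hp0.le hp1 (Nat.pow_le_pow_left (by omega) d)
    have h3 : p ^ d / 7 ^ d ^ 2 ≤ 1 :=
      div_le_one_of_le₀ ((pow_le_one₀ hp0.le hp1).trans (one_le_pow₀ (by norm_num))) (by positivity)
    have h4 : p * (p ^ d / 7 ^ d ^ 2) ≤ 1 := mul_le_one₀ hp1 (by positivity) h3
    calc A * (p * (p ^ d / 7 ^ d ^ 2)) / (n : ℝ) ^ d ^ 2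
        ≤ A * (p * (p ^ d / 7 ^ d ^ 2)) := div_le_self (by positivity) hnpow
      _ ≤ A := mul_le_of_le_one_right hA0.le h4
      _ ≤ _ := h2
  -- Since `y - x` has norm at most `2 * n` and `C < n`, radius `3 * n` suffices. Starting from `x`,
  -- partial sums stay within `4 * n`, and each step within a further `3 * n`.
  · obtain ⟨γ, hγ0, hγ1, hγ2, hγ3, hγ4, hγ5⟩ := exists_chamber_path hd0 (3 * n) (by omega)
    obtain ⟨U, w, hU, hw, hpart, hfin⟩ := hC (2 * n) (3 * n) (by omega) γ hγ0 hγ1 hγ2 hγ3 hγ4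
      (y - x) (fun i => by
        have h1 : |x i| ≤ n := hx i
        have h2 : |y i| ≤ n := hy i
        rw [Pi.sub_apply]
        refine (abs_sub _ _).trans ?_
        push_cast; linarith)
    set δ : ℝ := p / (2 * (3 * n : ℕ) + 1) ^ d with hδ
    have hδ0 : 0 < δ := by positivity
    have hδ1 : δ ≤ 1 := by
      refine div_le_one_of_le₀ (hp1.trans (one_le_pow₀ ?_)) (by positivity)
      push_cast; linarith
    have hchain := pow_mul_pow_le_measureReal_connectedIn U w x (3 * n) (4 * n) (9 * n) δ hδ0.le
      (fun u => by
        obtain ⟨t, ρ, h⟩ := hw u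
        exact hγ5 t (w u) ρ h)
      (fun U' hU' i => by
        have h1 : |x i| ≤ n := hx i
        have h2 := hpart U' hU' i
        refine (abs_add_le _ _).trans ?_
        push_cast at h2 ⊢
        omega) (by omega)
    have hlast := pow_le_measureReal_connectedIn (criticalProb d) C (9 * n) y (x + ∑ u ∈ U, w u) y
      (fun i => by
        have h1 := hfin i
        rw [Pi.sub_apply] at h1
        rw [Pi.add_apply, Finset.sum_apply]
        convert h1 using 2
        ring) (by simp) (fun i => by
        have h1 : |y i| ≤ n := hy i
        push_cast; omega)
    refine le_trans ?_ ((mul_le_mul hchain hlast (by positivity) measureReal_nonneg).trans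
      (measureReal_connectedIn_mul_le (criticalProb d) (9 * n) x _ y))
    -- The 7 comes from `2 * (3 * n) + 1 ≤ 7 * n`.
    have hδd : p ^ d / (7 ^ d ^ 2 * (n : ℝ) ^ d ^ 2) ≤ δ ^ U.card := by
      refine le_trans ?_ (pow_le_pow_of_le_one hδ0.le hδ1 hU)
      rw [hδ, div_pow, ← mul_pow, ← pow_mul, ← sq]
      refine div_le_div_of_nonneg_left (by positivity) (by positivity) ?_
      refine pow_le_pow_left₀ (by positivity) ?_ _
      push_cast; linarith
    calc A * (p * (p ^ d / 7 ^ d ^ 2)) / (n : ℝ) ^ d ^ 2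
        = p * (p ^ d / (7 ^ d ^ 2 * (n : ℝ) ^ d ^ 2)) * A := by
          rw [← div_div]; ring
      _ ≤ p * δ ^ U.card * A := by gcongr

end PointToPoint

end SitePercolation

end

theorem mainTheorem2 (d : ℕ) (hd : 2 ≤ d) :
    ∃ c' : ℝ, 0 < c' ∧
      ∀ n : ℕ, 1 ≤ n →
        ∀ x ∈ SitePercolation.box d n, ∀ y ∈ SitePercolation.box d n,
          c' / (n : ℝ) ^ (d ^ 2) ≤
            (SitePercolation.siteMeasure d (SitePercolation.criticalProb d)).real
              {ω | SitePercolation.ConnectedIn (SitePercolation.box d (9 * n)) x y ω} :=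
  SitePercolation.le_measureReal_connectedIn_criticalProb d hd
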